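/- **Setting.** Let $G,H$ be locally compact second countable (Hausdorff) abelian groups, and let $\mathcal L\subseteq G\times H$ be a discrete subgroup with compact quotient $\hat X:=(G\times H)/\mathcal L$, such that the projection $\pi^G:G\times H\to G$ is injective on $\mathcal L$ and the image of $\mathcal L$ under the projection to $H$ is dense in $H$. Let $W\subseteq H$ be compact (possibly empty). $G$ acts on $\hat X$ by $\hat T_g\hat x=(g,0)+\hat x$. Let $\mathcal M$ and $\mathcal M^G$ be the spaces of locally finite Borel measures on $G\times H$ and on $G$, with the vague topology (tested against compactly supported continuous functions); $G$ acts on them by translation, $(S_g\nu)(A)=\nu(-(g,0)+A)$ on $\mathcal M$ and $(S_g\nu)(A)=\nu(-g+A)$ on $\mathcal M^G$, and on $\hat X\times\mathcal M$ by $S_g(\hat x,\nu)=(\hat T_g\hat x,S_g\nu)$. For $\hat x=x+\mathcal L\in\hat X$ put $$\nu_W(\hat x)=\sum_{y\in(x+\mathcal L)\cap(G\times W)}\delta_y\in\mathcal M,\qquad \nu^G_W(\hat x)=\pi^G_*\nu_W(\hat x)\in\mathcal M^G .$$ Let $\mathcal M_W=\overline{\nu_W(\hat X)}\subseteq\mathcal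 M$, $\mathcal M^G_W=\overline{\nu^G_W(\hat X)}\subseteq\mathcal M^G$ and $\mathcal{GM}_W=\overline{\{(\hat x,\nu_W(\hat x)):\hat x\in\hat X\}}\subseteq\hat X\times\mathcal M$; these are invariant. Let $C_W\subseteq\hat X$ be the set of continuity points of $\nu_W$ and $Z_W=\{\hat x:\nu_W(\hat x)=0\}$. Let $\pi^{\hat X}_*:\mathcal{GM}_W\to\hat X$ and $\pi^{G\times H}_*:\mathcal{GM}_W\to\mathcal M_W$ be the coordinate projections. **Terminology.** A *factor map* (extension) is a continuous surjective $G$-equivariant map. It is a *topological almost 1-1 extension* if there is a dense $G_\delta$ set of points in the base whose fibres are singletons. An equicontinuous factor $\pi:Y\to X$ is the *maximal equicontinuous factor* of $Y$ if every factor map from $Y$ to an equicontinuous compact $G$-system factors through $\pi$. An *almost automorphic extension* is a minimal topological almost 1-1 extension. A system $Y$ is *topologically weakly mixing* if the diagonal action on $Y\times Y$ is topologically transitive. A *minimal subsystem* is a nonempty closed invariant subset on which every orbit is dense. **Theorem.** (a) If $\operatorname{int}(W)\neq\emptyset$, then $Z_W=\emptyset$, the map $\pi^{G\times H}_*:\mathcal{GM}_W\to\mathcal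 M_W$ is a homeomorphism, and both $$\pi^{\hat X}_*:(\mathcal{GM}_W,S)\to(\hat X,\hat T)\quad\text{and}\quad \pi^{\hat X}_*\circ(\pi^{G\times H}_*)^{-1}:(\mathcal M_W,S)\to(\hat X,\hat T)$$ are topological almost 1-1 extensions and exhibit $(\hat X,\hat T)$ as the maximal equicontinuous factor. If moreover $\hat X$ has more than one point, then neither $(\mathcal{GM}_W,S)$ nor $(\mathcal M_W,S)$ is topologically weakly mixing. Furthermore, the restrictions of these two maps to $\overline{\{(\hat x,\nu_W(\hat x)):\hat x\in C_W\}}\subseteq\mathcal{GM}_W$ and to $\overline{\nu_W(C_W)}\subseteq\mathcal M_W$, respectively, are almost automorphic extensions of $(\hat X,\hat T)$, and these two sets are the unique minimal subsystems of $(\mathcal{GM}_W,S)$ and of $(\mathcal M_W,S)$, respectively. (b) If $\operatorname{int}(W)=\emptyset$, then $Z_W\neq\emptyset$, and $\pi^{\hat X}_*:(\mathcal{GM}_W,S)\to(\hat X,\hat T)$ is a topological almost 1-1 extension and exhibits $(\hat X,\hat T)$ as the maximal equicontinuous factor, whereas every minimal equicontinuous factor of $(\mathcal M_W,S)$ and of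 $(\mathcal M^G_W,S)$ is a single point. Moreover, $(\mathcal M_W,S)$ is topologically weakly mixing if and only if $\mathcal M^G_W$ is a single point, and likewise $(\mathcal M^G_W,S)$ is topologically weakly mixing if and only if $\mathcal M^G_W$ is a single point. -/

import Mathlib

open MeasureTheory Topology TopologicalSpace Set
open scoped CompactlySupported

universe u v

/-! ## Topological dynamics of group actions -/

section Dynamics

variable (G : Type*) [AddGroup G]

/-- A factor map (extension) between two `G`-systems: a continuous equivariant surjection. -/
structure IsFactorMap {Y X : Type*} [TopologicalSpace Y] [TopologicalSpace X]
    [AddAction G Y] [AddAction G X] (π : Y → X) : Prop where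
  continuous : Continuous π
  surjective : Function.Surjective π
  map_vadd : ∀ (g : G) (y : Y), π (g +ᵥ y) = g +ᵥ π y

/-- The translations by elements of `G` form an equicontinuous family on the compact space `X`,
with respect to the uniform structure of `X` (unique, since `X` is compact). -/
def IsEquicontinuousSystem (X : Type*) [TopologicalSpace X] [CompactSpace X] [R1Space X]
    [AddAction G X] : Prop :=
  letI : UniformSpace X := uniformSpaceOfCompactR1
  Equicontinuous (fun (g : G) (x : X) => g +ᵥ x)

/-- `π : Y → X` exhibits `X` as the maximal equicontinuous factor of `Y`: `X` is an equicontinuous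
factor, and every equicontinuous factor of `Y` is a factor of `X`, compatibly with the maps from
`Y`. (A factor of `Y` is a quotient of `Y`, so the universe of `Y` sees all of them.) -/
def IsMaximalEquicontinuousFactor {Y : Type u} {X : Type v} [TopologicalSpace Y]
    [TopologicalSpace X] [CompactSpace X] [R1Space X] [AddAction G Y] [AddAction G X]
    [TopologicalSpace G] (π : Y → X) : Prop :=
  IsFactorMap G π ∧ IsEquicontinuousSystem G X ∧
    ∀ (Z : Type u) [TopologicalSpace Z] [CompactSpace Z] [T2Space Z] [AddAction G Z]
      [ContinuousVAdd G Z], IsEquicontinuousSystem G Z →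
      ∀ φ : Y → Z, IsFactorMap G φ → ∃ ψ : X → Z, IsFactorMap G ψ ∧ φ = ψ ∘ π

/-- A topological almost 1-1 extension: a factor map whose fibres over the points of some
dense `Gδ` subset of the base are singletons. -/
def IsAlmostOneOneExtension {Y X : Type*} [TopologicalSpace Y] [TopologicalSpace X]
    [AddAction G Y] [AddAction G X] (π : Y → X) : Prop :=
  IsFactorMap G π ∧ ∃ D : Set X, IsGδ D ∧ Dense D ∧ ∀ x ∈ D, ∃! y, π y = x

/-- An almost automorphic extension: a minimal topological almost 1-1 extension. -/
def IsAlmostAutomorphicExtension {Y X : Type*} [TopologicalSpace Y] [TopologicalSpace X]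
    [AddAction G Y] [AddAction G X] (π : Y → X) : Prop :=
  AddAction.IsMinimal G Y ∧ IsAlmostOneOneExtension G π

/-- Topological weak mixing: the product of the system with itself is topologically transitive. -/
def IsTopologicallyWeaklyMixing (Y : Type*) [TopologicalSpace Y] [AddAction G Y] : Prop :=
  AddAction.IsTopologicallyTransitive G (Y × Y)

/-- Every minimal equicontinuous factor of `Y` is trivial (consists of one point). -/
def HasNoNontrivialMinimalEquicontinuousFactor (Y : Type u) [TopologicalSpace Y]
    [TopologicalSpace G] [AddAction G Y] : Prop :=
  ∀ (Z : Type u) [TopologicalSpace Z] [CompactSpace Z] [T2Space Z] [AddAction G Z]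
    [ContinuousVAdd G Z], IsEquicontinuousSystem G Z → AddAction.IsMinimal G Z →
    ∀ φ : Y → Z, IsFactorMap G φ → Subsingleton Z

variable {G}

/-- `N` is a minimal subsystem of the system `Y` (both invariant subsets of a `G`-space `M`). -/
structure IsMinimalSubsystem {M : Type*} [TopologicalSpace M] [AddAction G M]
    (N Y : SubAddAction G M) : Prop where
  le : N ≤ Y
  isClosed : IsClosed (N : Set M)
  nonempty : (N : Set M).Nonempty
  isMinimal : AddAction.IsMinimal G N

/-- The closure of an invariant set, as a subsystem. -/
def closureSubsystem {M : Type*} [TopologicalSpace M] [AddAction G M] [ContinuousConstVAdd G M]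
    (s : Set M) (hs : ∀ (g : G), ∀ x ∈ s, g +ᵥ x ∈ s) : SubAddAction G M where
  carrier := closure s
  vadd_mem' g _ hx := map_mem_closure (continuous_const_vadd g) hx (hs g)

/-- The inclusion of a subsystem. -/
def subsystemInclusion {M : Type*} [AddAction G M] {N Y : SubAddAction G M} (h : N ≤ Y) :
    N → Y :=
  fun x => ⟨x.1, h x.2⟩

end Dynamics

/-! ## Locally finite measures with the vague topology -/

/-- The locally finite (Borel) measures on `E`. -/
@[ext]
structure LFMeasure (E : Type*) [TopologicalSpace E] [MeasurableSpace E] where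
  toMeasure : Measure E
  locallyFinite : IsLocallyFiniteMeasure toMeasure

namespace LFMeasure

section Vague

variable {E : Type*} [TopologicalSpace E] [MeasurableSpace E]

/-- The vague topology: the coarsest one for which `μ ↦ ∫ f dμ` is continuous for every
compactly supported continuous real function `f`. -/
noncomputable instance : TopologicalSpace (LFMeasure E) :=
  ⨅ f : C_c(E, ℝ), TopologicalSpace.induced (fun μ : LFMeasure E => ∫ x, f x ∂μ.toMeasure)
    inferInstance

theorem continuous_iff {Y : Type*} [TopologicalSpace Y] {F : Y → LFMeasure E} :
    Continuous F ↔ ∀ f : C_c(E, ℝ), Continuous fun y => ∫ x, f x ∂(F y).toMeasure := by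
  simp only [continuous_iInf_rng, continuous_induced_rng, Function.comp_def]

variable [AddCommGroup E] [IsTopologicalAddGroup E] [BorelSpace E]

/-- Translation of a measure by `e`: `(translate e μ) A = μ (A - e)`. -/
noncomputable def translate (e : E) (μ : LFMeasure E) : LFMeasure E where
  toMeasure := μ.toMeasure.map (fun x => e + x)
  locallyFinite := by
    refine ⟨fun x => ?_⟩
    have := μ.locallyFinite
    obtain ⟨U, hU, hμ⟩ := μ.toMeasure.finiteAt_nhds (-e + x)
    refine ⟨(fun y => -e + y) ⁻¹' U, (continuous_const_add (-e)).continuousAt hU, ?_⟩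
    have hm := (Homeomorph.addLeft e).toMeasurableEquiv.map_apply
      (μ := μ.toMeasure) ((fun y => -e + y) ⁻¹' U)
    have hpre : (Homeomorph.addLeft e).toMeasurableEquiv ⁻¹' ((fun y => -e + y) ⁻¹' U) = U := by
      ext y
      simp
    rw [hpre] at hm
    exact hm.trans_lt hμ

theorem translate_zero (μ : LFMeasure E) : translate 0 μ = μ := by
  ext1
  simp [translate]

theorem translate_add (a b : E) (μ : LFMeasure E) :
    translate (a + b) μ = translate a (translate b μ) := by
  ext1
  simp only [translate]
  rw [Measure.map_map (by fun_prop) (by fun_prop)]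
  congr 1
  funext x
  simp [add_assoc]

theorem continuous_translate (e : E) : Continuous (translate e : LFMeasure E → LFMeasure E) := by
  rw [continuous_iff]
  intro f
  have h1 : ∀ μ : LFMeasure E, ∫ x, f x ∂(translate e μ).toMeasure
      = ∫ x, f (e + x) ∂μ.toMeasure := fun μ =>
    (Homeomorph.addLeft e).measurableEmbedding.integral_map f
  simp only [h1]
  exact continuous_iff.1 continuous_id
    { toFun := fun x => f (e + x)
      continuous_toFun := f.continuous.comp (continuous_const_add e)
      hasCompactSupport' := f.hasCompactSupport.comp_homeomorph (Homeomorph.addLeft e) }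

end Vague

section Action

variable {G : Type*} [AddCommGroup G] [TopologicalSpace G] [IsTopologicalAddGroup G]
  [SecondCountableTopology G] [MeasurableSpace G] [BorelSpace G]
  {H : Type*} [AddCommGroup H] [TopologicalSpace H] [IsTopologicalAddGroup H]
  [SecondCountableTopology H] [MeasurableSpace H] [BorelSpace H]

/-- `G` acts on the measures on `G` by translation. -/
noncomputable instance instActionBase : AddAction G (LFMeasure G) where
  vadd g μ := translate g μ
  zero_vadd := translate_zero
  add_vadd := translate_add

instance : ContinuousConstVAdd G (LFMeasure G) := ⟨continuous_translate⟩

/-- `G` acts on the measures on `G × H` by translation in the first coordinate. -/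
noncomputable instance instActionProd : AddAction G (LFMeasure (G × H)) where
  vadd g μ := translate (g, 0) μ
  zero_vadd := translate_zero
  add_vadd a b μ := by
    have h : ((a + b, 0) : G × H) = (a, 0) + (b, 0) := by simp
    change translate _ μ = _
    rw [h]
    exact translate_add _ _ μ

instance : ContinuousConstVAdd G (LFMeasure (G × H)) := ⟨fun g => continuous_translate (g, 0)⟩

end Action

end LFMeasure

/-! ## Weak model sets -/

namespace ModelSet

variable {G : Type u} [AddCommGroup G] [TopologicalSpace G] [IsTopologicalAddGroup G]
  {H : Type v} [AddCommGroup H] [TopologicalSpace H] [IsTopologicalAddGroup H]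

/-- The quotient `X̂ = (G × H) / L`. -/
abbrev Torus (L : AddSubgroup (G × H)) : Type (max u v) := (G × H) ⧸ L

/-- The action of `G` on `X̂` by `x̂ ↦ (g, 0) + x̂`. -/
instance instActionTorus (L : AddSubgroup (G × H)) : AddAction G (Torus L) where
  vadd g x := ((g, 0) : G × H) + x
  zero_vadd x := zero_add x
  add_vadd a b x := by
    have h : ((a + b, 0) : G × H) = (a, 0) + (b, 0) := by simp
    change (((a + b, 0) : G × H) : Torus L) + x = _
    rw [h, QuotientAddGroup.mk_add, add_assoc]
    rfl

instance (L : AddSubgroup (G × H)) : ContinuousConstVAdd G (Torus L) :=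
  ⟨fun g => continuous_const_add (((g, 0) : G × H) : Torus L)⟩

/-- The points of the coset `x̂ = x + L` that lie in `G × W`. -/
def points (L : AddSubgroup (G × H)) (W : Compacts H) (x : Torus L) : Set (G × H) :=
  {y | (y : Torus L) = x ∧ y.2 ∈ W}

theorem vadd_mem_points {L : AddSubgroup (G × H)} {W : Compacts H} {x : Torus L} (g : G)
    {y : G × H} (hy : y ∈ points L W x) : (g, 0) + y ∈ points L W (g +ᵥ x) := by
  refine ⟨?_, by simpa using hy.2⟩
  rw [QuotientAddGroup.mk_add, hy.1]
  rfl

/-- Translation by `g` identifies the points over `x̂` with the points over `(g, 0) + x̂`. -/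
def pointsEquiv (L : AddSubgroup (G × H)) (W : Compacts H) (x : Torus L) (g : G) :
    points L W x ≃ points L W (g +ᵥ x) where
  toFun y := ⟨(g, 0) + y.1, vadd_mem_points g y.2⟩
  invFun y := ⟨(-g, 0) + y.1, by simpa using vadd_mem_points (-g) y.2⟩
  left_inv y := by ext <;> simp
  right_inv y := by ext <;> simp

variable [T2Space G] [T2Space H]

theorem finite_points_inter (L : AddSubgroup (G × H)) [DiscreteTopology L] (W : Compacts H)
    (x : Torus L) {K : Set (G × H)} (hK : IsCompact K) : (points L W x ∩ K).Finite := by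
  obtain ⟨a, rfl⟩ := QuotientAddGroup.mk_surjective x
  have hL : IsClosed (L : Set (G × H)) := AddSubgroup.isClosed_of_discrete
  have hK' : IsCompact ((fun y => -a + y) '' K) := hK.image (continuous_const_add (-a))
  have hd : IsDiscrete (L : Set (G × H)) := ⟨inferInstanceAs (DiscreteTopology L)⟩
  have hfin : (((fun y => -a + y) '' K) ∩ (L : Set (G × H))).Finite :=
    (hK'.inter_right hL).finite (hd.mono inter_subset_right)
  refine (hfin.image (fun y => a + y)).subset ?_
  rintro y ⟨hy, hyK⟩
  exact ⟨-a + y, ⟨⟨y, hyK, rfl⟩, QuotientAddGroup.eq.1 hy.1.symm⟩, by simp⟩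

variable [LocallyCompactSpace G] [SecondCountableTopology G] [MeasurableSpace G] [BorelSpace G]
  [LocallyCompactSpace H] [SecondCountableTopology H] [MeasurableSpace H] [BorelSpace H]

/-- The measure `∑ δ_y`, the sum over all `y ∈ (x + L) ∩ (G × W)`. -/
noncomputable def diracComb (L : AddSubgroup (G × H)) (W : Compacts H) (x : Torus L) :
    Measure (G × H) :=
  Measure.sum fun y : points L W x => Measure.dirac y.1

theorem diracComb_lt_top (L : AddSubgroup (G × H)) (W : Compacts H) (x : Torus L)
    {A : Set (G × H)} (hA : MeasurableSet A) (hfin : (points L W x ∩ A).Finite) :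
    diracComb L W x A < ⊤ := by
  rw [diracComb, Measure.sum_apply _ hA]
  have hfin' : {y : points L W x | y.1 ∈ A}.Finite := by
    refine Finite.of_finite_image (f := Subtype.val) (hfin.subset ?_) Subtype.val_injective.injOn
    rintro _ ⟨y, hy, rfl⟩
    exact ⟨y.2, hy⟩
  rw [tsum_eq_sum (s := hfin'.toFinset)]
  · exact ENNReal.sum_lt_top.2 fun y _ => measure_lt_top _ _
  · intro y hy
    have hy' : y.1 ∉ A := by simpa using hy
    rw [Measure.dirac_apply' _ hA]
    simp [hy']

/-- The configuration `ν_W(x̂) = ∑ δ_y` on `G × H`, the sum over all `y ∈ (x + L) ∩ (G × W)`. -/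
noncomputable def nu (L : AddSubgroup (G × H)) [DiscreteTopology L] (W : Compacts H)
    (x : Torus L) : LFMeasure (G × H) where
  toMeasure := diracComb L W x
  locallyFinite := by
    have : IsFiniteMeasureOnCompacts (diracComb L W x) :=
      ⟨fun K hK => diracComb_lt_top L W x hK.measurableSet (finite_points_inter L W x hK)⟩
    exact isLocallyFiniteMeasure_of_isFiniteMeasureOnCompacts

/-- The projected configuration `ν^G_W(x̂)` on `G`: the image of `ν_W(x̂)` under `G × H → G`. -/
noncomputable def nuG (L : AddSubgroup (G × H)) [DiscreteTopology L] (W : Compacts H)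
    (x : Torus L) : LFMeasure G where
  toMeasure := (nu L W x).toMeasure.map Prod.fst
  locallyFinite := by
    have : IsFiniteMeasureOnCompacts ((nu L W x).toMeasure.map Prod.fst) := by
      refine ⟨fun K hK => ?_⟩
      rw [Measure.map_apply measurable_fst hK.measurableSet]
      refine diracComb_lt_top L W x (measurable_fst hK.measurableSet) ?_
      refine (finite_points_inter L W x (hK.prod W.isCompact)).subset ?_
      exact fun y hy => ⟨hy.1, hy.2, hy.1.2⟩
    exact isLocallyFiniteMeasure_of_isFiniteMeasureOnCompacts

variable (L : AddSubgroup (G × H)) [DiscreteTopology L] (W : Compacts H)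

theorem nu_vadd (g : G) (x : Torus L) : nu L W (g +ᵥ x) = g +ᵥ nu L W x := by
  ext A hA
  change diracComb L W (g +ᵥ x) A = (diracComb L W x).map (fun y => (g, 0) + y) A
  have hm : Measurable fun y : G × H => (g, 0) + y := by fun_prop
  rw [Measure.map_apply hm hA, diracComb, diracComb, Measure.sum_apply _ hA,
    Measure.sum_apply _ (hm hA), ← (pointsEquiv L W x g).tsum_eq]
  refine tsum_congr fun y => ?_
  rw [Measure.dirac_apply' _ hA, Measure.dirac_apply' _ (hm hA)]
  rfl

theorem nuG_vadd (g : G) (x : Torus L) : nuG L W (g +ᵥ x) = g +ᵥ nuG L W x := by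
  ext1
  change (nu L W (g +ᵥ x)).toMeasure.map Prod.fst
    = ((nu L W x).toMeasure.map Prod.fst).map (fun y => g + y)
  rw [nu_vadd]
  change ((nu L W x).toMeasure.map (fun y => (g, 0) + y)).map Prod.fst = _
  rw [Measure.map_map (by fun_prop) (by fun_prop), Measure.map_map (by fun_prop) (by fun_prop)]
  rfl

/-- The set `C_W` of continuity points of `ν_W` (for the vague topology). -/
def continuitySet : Set (Torus L) := {x | ContinuousAt (nu L W) x}

/-- The set `Z_W` of all `x̂` for which `ν_W(x̂)` is the zero measure. -/
def zeroSet : Set (Torus L) := {x | (nu L W x).toMeasure = 0}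

theorem vadd_mem_continuitySet (g : G) {x : Torus L} (hx : x ∈ continuitySet L W) :
    g +ᵥ x ∈ continuitySet L W := by
  have h1 : nu L W = fun y => g +ᵥ nu L W (-g +ᵥ y) := by
    funext y
    rw [← nu_vadd, vadd_neg_vadd]
  have h2 : ContinuousAt (nu L W) (-g +ᵥ (g +ᵥ x)) := by
    rw [neg_vadd_vadd]
    exact hx
  have h3 : ContinuousAt (fun y : Torus L => nu L W (-g +ᵥ y)) (g +ᵥ x) :=
    ContinuousAt.comp (f := fun y : Torus L => -g +ᵥ y) h2
      (continuous_const_vadd (-g)).continuousAt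
  change ContinuousAt (nu L W) (g +ᵥ x)
  rw [h1]
  exact (continuous_const_vadd g).continuousAt.comp h3

/-- The hull `M_W`: the vague closure of `ν_W(X̂)`. -/
noncomputable def hull : SubAddAction G (LFMeasure (G × H)) :=
  closureSubsystem (range (nu L W)) (by
    rintro g _ ⟨x, rfl⟩
    exact ⟨g +ᵥ x, nu_vadd L W g x⟩)

/-- The hull `M^G_W`: the vague closure of `ν^G_W(X̂)`. -/
noncomputable def hullG : SubAddAction G (LFMeasure G) :=
  closureSubsystem (range (nuG L W)) (by
    rintro g _ ⟨x, rfl⟩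
    exact ⟨g +ᵥ x, nuG_vadd L W g x⟩)

/-- The system `GM_W`: the closure of the graph of `ν_W` in `X̂ × M`. -/
noncomputable def graphHull : SubAddAction G (Torus L × LFMeasure (G × H)) :=
  closureSubsystem (range fun x => (x, nu L W x)) (by
    rintro g _ ⟨x, rfl⟩
    exact ⟨g +ᵥ x, Prod.ext rfl (nu_vadd L W g x)⟩)

/-- The closure of `ν_W(C_W)`. -/
noncomputable def contHull : SubAddAction G (LFMeasure (G × H)) :=
  closureSubsystem (nu L W '' continuitySet L W) (by
    rintro g _ ⟨x, hx, rfl⟩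
    exact ⟨g +ᵥ x, vadd_mem_continuitySet L W g hx, nu_vadd L W g x⟩)

/-- The closure of the graph of the restriction of `ν_W` to `C_W`. -/
noncomputable def contGraphHull : SubAddAction G (Torus L × LFMeasure (G × H)) :=
  closureSubsystem ((fun x => (x, nu L W x)) '' continuitySet L W) (by
    rintro g _ ⟨x, hx, rfl⟩
    exact ⟨g +ᵥ x, vadd_mem_continuitySet L W g hx, Prod.ext rfl (nu_vadd L W g x)⟩)

theorem contHull_le : contHull L W ≤ hull L W :=
  closure_mono (image_subset_range _ _)

theorem contGraphHull_le : contGraphHull L W ≤ graphHull L W :=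
  closure_mono (image_subset_range _ _)

/-- The projection `GM_W → X̂`, `(x̂, ν) ↦ x̂`. -/
def projTorus : graphHull L W → Torus L := fun p => p.1.1

/-- The projection `GM_W → M_W`, `(x̂, ν) ↦ ν`. -/
def projHull : graphHull L W → hull L W := fun p =>
  ⟨p.1.2, map_mem_closure continuous_snd p.2 (by
    rintro _ ⟨x, rfl⟩
    exact ⟨x, rfl⟩)⟩

end ModelSet

open ModelSet

/-! The torus `X̂` is a compact group on which `G` acts by translations, so it is equicontinuous,
and it is minimal because `L` projects densely to `H`. The map `ν_W` can only jump at `x̂` if a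
point of the coset lies over the boundary of `W`. As `L` is countable and the boundary of a closed
set is nowhere dense, Baire's theorem makes the remaining generic points a dense Gδ
(`dense_genericSet`, `isGδ_genericSet`, `continuousAt_nu`).

Over a continuity point `x₀` the closure of the graph has a single point, and points over a
neighbourhood of `x₀` are near it (`tendsto_snd_of_continuousAt`). This gives the almost 1-1
property. It also gives maximality: two points of the extension over nearby base points can be moved
by one `g` over a small neighbourhood of `x₀`, where every factor nearly identifies them, and an
equicontinuous factor lets one move back. In the same way every orbit closure contains the graph
over all continuity points, which yields the unique minimal subsystem.

If `W` has interior, one test function has integral at least 1 against every configuration, so no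
limit configuration vanishes. A configuration over `x̂` is carried by the coset `x̂`, hence a
nonzero one determines `x̂`, and the graph hull is homeomorphic to the hull.

If `W` has no interior, generic configurations vanish. The zero measure is then a fixed point of
both hulls, and it trivializes minimal factors. For weak mixing the key is
`exists_mem_closure_graph_of_isTopologicallyWeaklyMixing`: any two configurations occur over a
common torus point. Projected point sets are therefore directed under inclusion. If `W` contained a
point, compactness would give a coset whose points over `W` project onto all of `G`. Injectivity on
`L` would put the whole coset over `W`, and density would give `W = H`, contrary to the empty
interior. -/

set_option linter.unusedSectionVars false

/-! ### Equicontinuous factors and group rotations. -/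

section Dynamics

variable {G : Type*} [AddGroup G]

/-- If a fibre of a factor map onto a minimal system consists of one point in the strong sense
that points over a neighbourhood of `x₀` are near `p₀`, then the factor is the maximal
equicontinuous factor as soon as it is equicontinuous. -/
theorem IsFactorMap.isMaximalEquicontinuousFactor {Y : Type u} {X : Type v} [TopologicalSpace G]
    [TopologicalSpace Y] [TopologicalSpace X] [CompactSpace X] [R1Space X] [AddAction G Y]
    [AddAction G X] [ContinuousConstVAdd G X] [AddAction.IsMinimal G X] {π : Y → X}
    (hπ : IsFactorMap G π) (hX : IsEquicontinuousSystem G X) {x₀ : X} {p₀ : Y}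
    (h₀ : Filter.comap π (𝓝 x₀) ≤ 𝓝 p₀) : IsMaximalEquicontinuousFactor G π := by
  refine ⟨hπ, hX, fun Z _ _ _ _ _ hZ φ hφ => ?_⟩
  let _ : UniformSpace Z := uniformSpaceOfCompactR1
  have hZ' : UniformEquicontinuous (fun (g : G) (x : Z) => g +ᵥ x) :=
    CompactSpace.uniformEquicontinuous_of_equicontinuous hZ
  -- Continuity of the induced map and its being well defined come from the same estimate: `φ p` and
  -- `φ p'` are close once `π p'` is near `π p`. Minimality supplies `g` bringing both points over a
  -- small neighbourhood of `x₀`, and `-g` brings them back with uniform control.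
  have key : ∀ V ∈ uniformity Z, ∀ x : X, ∀ᶠ x' in 𝓝 x, ∀ p p' : Y, π p = x → π p' = x' →
      (φ p, φ p') ∈ V := by
    intro V hV x
    obtain ⟨V₁, hV₁, hV₁V⟩ : ∃ V₁ ∈ uniformity Z, ∀ z z' : Z, (z, z') ∈ V₁ →
        ∀ g : G, (g +ᵥ z, g +ᵥ z') ∈ V :=
      ⟨_, hZ' V hV, fun z z' h => h⟩
    obtain ⟨V₂, hV₂, hsymm, hcomp⟩ := comp_symm_mem_uniformity_sets hV₁
    have hO : φ ⁻¹' (UniformSpace.ball (φ p₀) V₂) ∈ Filter.comap π (𝓝 x₀) :=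
      h₀ (hφ.continuous.continuousAt (UniformSpace.ball_mem_nhds _ hV₂))
    obtain ⟨U, hU, hUO⟩ := hO
    obtain ⟨g, hg⟩ := (isOpen_interior (s := U)).exists_vadd_mem G x
      ⟨x₀, mem_interior_iff_mem_nhds.2 hU⟩
    have hev : ∀ᶠ x' in 𝓝 x, g +ᵥ x' ∈ interior U :=
      (continuous_const_vadd g).continuousAt (isOpen_interior.mem_nhds hg)
    filter_upwards [hev] with x' hx' p p' hp hp'
    have h1 : (φ p₀, φ (g +ᵥ p)) ∈ V₂ := hUO (by
      rw [mem_preimage, hπ.map_vadd, hp]; exact interior_subset hg)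
    have h2 : (φ p₀, φ (g +ᵥ p')) ∈ V₂ := hUO (by
      rw [mem_preimage, hπ.map_vadd, hp']; exact interior_subset hx')
    have h3 : (φ (g +ᵥ p), φ (g +ᵥ p')) ∈ V₁ := hcomp ⟨φ p₀, hsymm.symm _ _ h1, h2⟩
    have h4 := hV₁V _ _ h3 (-g)
    rwa [hφ.map_vadd, hφ.map_vadd, neg_vadd_vadd, neg_vadd_vadd] at h4
  have hfib : ∀ p p' : Y, π p = π p' → φ p = φ p' := fun p p' hpp' =>
    eq_of_uniformity fun {V} hV => (key V hV (π p)).self_of_nhds p p' rfl hpp'.symm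
  refine ⟨φ ∘ Function.surjInv hπ.surjective, ⟨?_, ?_, ?_⟩, ?_⟩
  · refine continuous_iff_continuousAt.2 fun x => Uniform.continuousAt_iff'_right.2 ?_
    refine Filter.tendsto_def.2 fun V hV => ?_
    filter_upwards [key V hV x] with x' hx'
    exact hx' _ _ (Function.surjInv_eq hπ.surjective _) (Function.surjInv_eq hπ.surjective _)
  · intro z
    obtain ⟨p, rfl⟩ := hφ.surjective z
    exact ⟨π p, hfib _ _ (Function.surjInv_eq hπ.surjective _)⟩
  · intro g x
    rw [Function.comp_apply, Function.comp_apply, ← hφ.map_vadd]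
    refine hfib _ _ ?_
    rw [hπ.map_vadd, Function.surjInv_eq hπ.surjective, Function.surjInv_eq hπ.surjective]
  · funext p
    exact hfib _ _ (Function.surjInv_eq hπ.surjective _).symm

/-- The translations of a compact group form an equicontinuous system. -/
theorem isEquicontinuousSystem_of_vadd_eq_add {X : Type*} [AddCommGroup X] [TopologicalSpace X]
    [IsTopologicalAddGroup X] [CompactSpace X] [R1Space X] [AddAction G X]
    (hadd : ∀ (g : G) (x y : X), g +ᵥ (x + y) = (g +ᵥ x) + y) :
    IsEquicontinuousSystem G X := by
  let _ : UniformSpace X := uniformSpaceOfCompactR1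
  intro x₀ V hV
  have h : ∀ t ∈ (univ : Set X), ∀ᶠ p : X × X in 𝓝 (x₀, t), (p.2 + x₀, p.2 + p.1) ∈ V := by
    intro t _
    have hc : ContinuousAt (fun p : X × X => (p.2 + x₀, p.2 + p.1)) (x₀, t) := by fun_prop
    exact hc (nhds_le_uniformity (t + x₀) hV)
  filter_upwards [isCompact_univ.eventually_forall_of_forall_eventually
    (P := fun x t : X => (t + x₀, t + x) ∈ V) h] with x hx g
  -- Every `g` acts as translation by `t = g +ᵥ 0`, so the estimate uniform over the compact set of
  -- all `t` covers all `g`.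
  have h1 : ∀ y : X, g +ᵥ y = (g +ᵥ (0 : X)) + y := fun y => by rw [← hadd, zero_add]
  simp only [h1 x₀, h1 x]
  exact hx _ (mem_univ _)

/-- A system with a nontrivial group rotation as a factor is not topologically weakly mixing. -/
theorem IsFactorMap.not_isTopologicallyWeaklyMixing {Y X : Type*} [TopologicalSpace Y]
    [AddAction G Y] [AddCommGroup X] [TopologicalSpace X] [IsTopologicalAddGroup X] [T2Space X]
    [AddAction G X] [Nontrivial X] (hadd : ∀ (g : G) (x y : X), g +ᵥ (x + y) = (g +ᵥ x) + y)
    {π : Y → X} (hπ : IsFactorMap G π) : ¬ IsTopologicallyWeaklyMixing G Y := by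
  intro h
  obtain ⟨c, hc⟩ := exists_ne (0 : X)
  obtain ⟨A, B, hA, hB, hcA, h0B, hAB⟩ := t2_separation hc
  -- The difference of the base points is a continuous invariant function on `Y × Y` taking the
  -- distinct values `c` and `0`, which transitivity forbids.
  have hcont : Continuous fun p : Y × Y => π p.1 - π p.2 :=
    (hπ.continuous.comp continuous_fst).sub (hπ.continuous.comp continuous_snd)
  obtain ⟨yc, hyc⟩ := hπ.surjective c
  obtain ⟨y0, hy0⟩ := hπ.surjective 0
  obtain ⟨g, _, ⟨p, hp, rfl⟩, hp'⟩ := h.exists_vadd_inter (hA.preimage hcont)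
    ⟨(yc, y0), by simpa [hyc, hy0] using hcA⟩ (hB.preimage hcont) ⟨(y0, y0), by simpa using h0B⟩
  have h1 : ∀ y : X, g +ᵥ y = (g +ᵥ (0 : X)) + y := fun y => by rw [← hadd, zero_add]
  have h2 : π (g +ᵥ p).1 - π (g +ᵥ p).2 = π p.1 - π p.2 := by
    rw [Prod.vadd_fst, Prod.vadd_snd, hπ.map_vadd, hπ.map_vadd, h1 (π p.1), h1 (π p.2)]
    abel
  refine disjoint_left.1 hAB hp ?_
  change π (g +ᵥ p).1 - π (g +ᵥ p).2 ∈ B at hp'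
  rwa [h2] at hp'

/-! ### Minimal subsystems, fixed points and weak mixing. -/

section Subsystem

variable {M : Type*} [TopologicalSpace M] [AddAction G M]

theorem isMinimal_of_forall_mem_closure_orbit {N : SubAddAction G M}
    (h : ∀ x ∈ N, (N : Set M) ⊆ closure (AddAction.orbit G x)) : AddAction.IsMinimal G N := by
  refine ⟨fun x => ?_⟩
  rw [Subtype.dense_iff]
  have hx : ((↑) : N → M) '' AddAction.orbit G x = AddAction.orbit G (x : M) := by
    ext z
    constructor
    · rintro ⟨_, ⟨g, rfl⟩, rfl⟩
      exact ⟨g, rfl⟩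
    · rintro ⟨g, rfl⟩
      exact ⟨_, ⟨g, rfl⟩, rfl⟩
  exact (h x x.2).trans (closure_mono hx.ge)

theorem subset_closure_orbit {N : SubAddAction G M} (h : AddAction.IsMinimal G N)
    {x : M} (hx : x ∈ N) : (N : Set M) ⊆ closure (AddAction.orbit G x) := by
  have h1 := Subtype.dense_iff.1 (h.dense_orbit ⟨x, hx⟩)
  refine h1.trans (closure_mono ?_)
  rintro _ ⟨_, ⟨g, rfl⟩, rfl⟩
  exact ⟨g, rfl⟩

theorem closure_orbit_subset {N : SubAddAction G M} (hN : IsClosed (N : Set M))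
    {x : M} (hx : x ∈ N) : closure (AddAction.orbit G x) ⊆ N := by
  refine closure_minimal ?_ hN
  rintro _ ⟨g, rfl⟩
  exact N.vadd_mem g hx

variable [ContinuousConstVAdd G M]

/-- If the points of `C` lie in all orbit closures of `Y`, then `closure C` is minimal. -/
theorem isMinimal_closureSubsystem {Y : SubAddAction G M} {C : Set M}
    (hC : ∀ (g : G), ∀ x ∈ C, g +ᵥ x ∈ C) (hle : closureSubsystem C hC ≤ Y)
    (h : ∀ p ∈ Y, C ⊆ closure (AddAction.orbit G p)) :
    AddAction.IsMinimal G (closureSubsystem C hC) :=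
  isMinimal_of_forall_mem_closure_orbit fun x hx =>
    closure_minimal (h x (hle hx)) isClosed_closure

/-- If the points of `C` lie in all orbit closures of `Y`, then `closure C` is the unique minimal
subsystem of `Y`. -/
theorem isMinimalSubsystem_iff_eq_closureSubsystem {Y : SubAddAction G M} {C : Set M}
    (hC : ∀ (g : G), ∀ x ∈ C, g +ᵥ x ∈ C) (hne : C.Nonempty) (hle : closureSubsystem C hC ≤ Y)
    (h : ∀ p ∈ Y, C ⊆ closure (AddAction.orbit G p)) (N : SubAddAction G M) :
    IsMinimalSubsystem N Y ↔ N = closureSubsystem C hC := by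
  constructor
  · intro hN
    obtain ⟨p, hp⟩ := hN.nonempty
    have h1 : closure C ⊆ N :=
      (closure_minimal (h p (hN.le hp)) isClosed_closure).trans
        (closure_orbit_subset hN.isClosed hp)
    obtain ⟨c, hc⟩ := hne
    have h2 : (N : Set M) ⊆ closure C :=
      (subset_closure_orbit hN.isMinimal (h1 (subset_closure hc))).trans
        (closure_orbit_subset (N := closureSubsystem C hC) isClosed_closure
          (subset_closure hc))
    exact SetLike.coe_injective (h2.antisymm h1)
  · rintro rfl
    exact ⟨hle, isClosed_closure, hne.mono subset_closure, isMinimal_closureSubsystem hC hle h⟩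

/-- A system with a fixed point has no nontrivial minimal factors. -/
theorem hasNoNontrivialMinimalEquicontinuousFactor_of_fixedPoint {Y : Type u} [TopologicalSpace Y]
    [TopologicalSpace G] [AddAction G Y] {y₀ : Y} (hy₀ : ∀ g : G, g +ᵥ y₀ = y₀) :
    HasNoNontrivialMinimalEquicontinuousFactor G Y := by
  intro Z _ _ _ _ _ _ hmin φ hφ
  have h1 : AddAction.orbit G (φ y₀) = {φ y₀} := by
    ext z
    constructor
    · rintro ⟨g, rfl⟩
      change g +ᵥ φ y₀ = φ y₀
      rw [← hφ.map_vadd, hy₀]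
    · rintro rfl
      exact AddAction.mem_orbit_self _
  have h2 : ∀ z, z = φ y₀ := fun z => by
    have h3 := hmin.dense_orbit (φ y₀) z
    rwa [h1, closure_singleton] at h3
  exact ⟨fun a b => (h2 a).trans (h2 b).symm⟩

theorem isTopologicallyWeaklyMixing_of_subsingleton {Y : Type*} [TopologicalSpace Y]
    [AddAction G Y] [Subsingleton Y] : IsTopologicallyWeaklyMixing G Y := by
  refine ⟨fun {U V} _ hU _ hV => ⟨0, ?_⟩⟩
  obtain ⟨p, hp⟩ := hU
  obtain ⟨q, hq⟩ := hV
  exact ⟨q, ⟨p, hp, Subsingleton.elim _ _⟩, hq⟩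

/-- If the hull of an equivariant map on a compact group rotation is topologically weakly mixing,
then any two values of the map occur over a common point of the closure of its graph. -/
theorem exists_mem_closure_graph_of_isTopologicallyWeaklyMixing {X : Type*} [AddCommGroup X]
    [TopologicalSpace X] [IsTopologicalAddGroup X] [CompactSpace X] [T2Space X] [AddAction G X]
    [ContinuousConstVAdd G X] [AddAction.IsMinimal G X]
    (hadd : ∀ (g : G) (x y : X), g +ᵥ (x + y) = (g +ᵥ x) + y) {N : X → M}
    (hN : ∀ (g : G) (x : X), N (g +ᵥ x) = g +ᵥ N x)
    (hs : ∀ (g : G), ∀ x ∈ range N, g +ᵥ x ∈ range N)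
    (h : IsTopologicallyWeaklyMixing G (closureSubsystem (range N) hs)) (x₁ x₂ : X) :
    ∃ x, (x, N x₁) ∈ closure (range fun x => (x, N x)) ∧
      (x, N x₂) ∈ closure (range fun x => (x, N x)) := by
  set Y := closureSubsystem (range N) hs
  set Γ := closure (range fun x => (x, N x))
  let n : X → Y := fun x => ⟨N x, subset_closure ⟨x, rfl⟩⟩
  have hn : ∀ (g : G) (x : X), n (g +ᵥ x) = g +ᵥ n x := fun g x => Subtype.ext (hN g x)
  have hnd : DenseRange n := by
    rw [DenseRange, Subtype.dense_iff]
    have : ((↑) : Y → M) '' range n = range N := by rw [← range_comp]; rfl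
    exact (subset_rfl : (Y : Set M) ⊆ closure (range N)).trans (closure_mono this.ge)
  have : ContinuousConstVAdd G Y :=
    ⟨fun g => ((continuous_const_vadd g).comp continuous_subtype_val).subtype_mk _⟩
  let n2 : X × X → Y × Y := Prod.map n n
  have hn2d : DenseRange n2 := hnd.prodMap hnd
  have hn2 : ∀ (g : G) p, n2 (g +ᵥ p) = g +ᵥ n2 p := fun g p =>
    Prod.ext (hn g p.1) (hn g p.2)
  have h1 : ∀ (g : G) (y : X), g +ᵥ y = (g +ᵥ (0 : X)) + y := fun g y => by
    rw [← hadd, zero_add]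
  -- `D V` collects the differences `x - x'` of pairs whose values lie in `V`. The goal is one `d`
  -- in the closure of every `D V`. Differences are invariant under the diagonal action, so a pair
  -- whose orbit visits finitely many `V` has its difference in all their `D V`.
  let D : Set (Y × Y) → Set X := fun V => (fun p : X × X => p.1 - p.2) '' (n2 ⁻¹' V)
  let ι := {V : Set (Y × Y) // IsOpen V ∧ V.Nonempty}
  obtain ⟨d, hd⟩ : (⋂ V : ι, closure (D V)).Nonempty := by
    by_contra hcon
    obtain ⟨F, hF⟩ := isCompact_univ.elim_finite_subfamily_closed (fun V : ι => closure (D V))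
      (fun V => isClosed_closure) (by rw [univ_inter]; exact not_nonempty_iff_eq_empty.1 hcon)
    have hW : ∀ F : Finset ι, IsOpen (⋂ V ∈ F, ⋃ g : G, (g +ᵥ ·) ⁻¹' (V : Set (Y × Y))) ∧
        Dense (⋂ V ∈ F, ⋃ g : G, (g +ᵥ ·) ⁻¹' (V : Set (Y × Y))) := by
      classical
      intro F
      induction F using Finset.induction_on with
      | empty => simp
      | insert V F _ ih =>
        have ho : IsOpen (⋃ g : G, (g +ᵥ ·) ⁻¹' (V : Set (Y × Y))) :=
          isOpen_iUnion fun g => V.2.1.preimage (continuous_const_vadd g)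
        have hden : Dense (⋃ g : G, (g +ᵥ ·) ⁻¹' (V : Set (Y × Y))) :=
          haveI : AddAction.IsTopologicallyTransitive G (Y × Y) := h
          V.2.1.dense_iUnion_preimage_vadd G V.2.2
        rw [Finset.set_biInter_insert]
        exact ⟨ho.inter ih.1, hden.inter_of_isOpen_left ih.2 ho⟩
    obtain ⟨p, hp⟩ := hn2d.exists_mem_open (hW F).1
      ((hW F).2.nonempty_iff.2 ⟨n2 (0, 0)⟩)
    have : p.1 - p.2 ∈ ⋂ V ∈ F, closure (D V) := by
      refine mem_iInter₂.2 fun V hV => subset_closure ?_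
      obtain ⟨g, hg⟩ := mem_iUnion.1 (mem_iInter₂.1 hp V hV)
      refine ⟨g +ᵥ p, ?_, ?_⟩
      · rw [mem_preimage, hn2]
        exact hg
      · change (g +ᵥ p.1) - (g +ᵥ p.2) = _
        rw [h1 g p.1, h1 g p.2]
        abel
    exact notMem_empty _ (hF.subset ⟨mem_univ _, this⟩)
  -- Since `d` lies in the closure of `D V` for every neighbourhood `V` of `(N x, N x')`, there are
  -- pairs with values tending to `(N x, N x')` and difference tending to `d`. Compactness of `X ×
  -- X` gives the limit pair `(y, y')`.
  have hd' : ∀ x x' : X, ∃ y y' : X, (y, N x) ∈ Γ ∧ (y', N x') ∈ Γ ∧ y - y' = d := by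
    intro x x'
    let f : X × X → (M × M) × X := fun p => ((N p.1, N p.2), p.1 - p.2)
    have hne : (Filter.comap f (𝓝 ((N x, N x'), d))).NeBot := by
      rw [Filter.comap_neBot_iff_frequently, nhds_prod_eq,
        (((nhds_basis_opens _).prod_nhds (nhds_basis_opens _)).prod (nhds_basis_opens d)).frequently_iff]
      rintro ⟨⟨A, B⟩, O⟩ ⟨⟨⟨hxA, hA⟩, hxB, hB⟩, hdO, hO⟩
      let V : ι := ⟨(((↑) : Y → M) ⁻¹' A) ×ˢ (((↑) : Y → M) ⁻¹' B),
        (hA.preimage continuous_subtype_val).prod (hB.preimage continuous_subtype_val),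
        ⟨n2 (x, x'), hxA, hxB⟩⟩
      obtain ⟨_, he, p, hp, rfl⟩ := mem_closure_iff.1 (mem_iInter.1 hd V) O hO hdO
      exact ⟨f p, ⟨⟨hp.1, hp.2⟩, he⟩, p, rfl⟩
    obtain ⟨⟨y, y'⟩, hy⟩ := exists_clusterPt_of_compactSpace (Filter.comap f (𝓝 ((N x, N x'), d)))
    obtain ⟨𝓤, h𝓤y, h𝓤⟩ := Filter.exists_ultrafilter_iff.2 hy |>.imp fun 𝓤 h => le_inf_iff.1 h
    have ht : Filter.Tendsto f 𝓤 (𝓝 ((N x, N x'), d)) := Filter.tendsto_iff_comap.2 h𝓤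
    have h3 : Filter.Tendsto (fun p : X × X => p.1) 𝓤 (𝓝 y) :=
      (continuous_fst.tendsto (y, y')).mono_left h𝓤y
    have h4 : Filter.Tendsto (fun p : X × X => p.2) 𝓤 (𝓝 y') :=
      (continuous_snd.tendsto (y, y')).mono_left h𝓤y
    refine ⟨y, y', ?_, ?_, ?_⟩
    · exact mem_closure_of_tendsto (h3.prodMk_nhds ht.fst_nhds.fst_nhds)
        (Filter.Eventually.of_forall fun p => ⟨p.1, rfl⟩)
    · exact mem_closure_of_tendsto (h4.prodMk_nhds ht.fst_nhds.snd_nhds)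
        (Filter.Eventually.of_forall fun p => ⟨p.2, rfl⟩)
    · exact tendsto_nhds_unique (h3.sub h4) ht.snd_nhds
  have hfib : ∀ x, IsCompact {y | (y, N x) ∈ Γ} := fun x =>
    (isClosed_closure.preimage (Continuous.prodMk_left (N x))).isCompact
  have hE : IsClosed ((fun p : X × X => p.1 - p.2) ''
      ({y | (y, N x₁) ∈ Γ} ×ˢ {y | (y, N x₂) ∈ Γ})) :=
    (((hfib x₁).prod (hfib x₂)).image (by fun_prop)).isClosed
  -- Applying the previous step to `x₁` and `g +ᵥ x₂` and then moving only the second point back by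
  -- `-g` changes the difference from `d` to `g +ᵥ d`. The set of differences is closed and contains
  -- a dense orbit, so it contains `0`.
  have hsub : AddAction.orbit G d ⊆ (fun p : X × X => p.1 - p.2) ''
      ({y | (y, N x₁) ∈ Γ} ×ˢ {y | (y, N x₂) ∈ Γ}) := by
    rintro _ ⟨g, rfl⟩
    obtain ⟨y, y', hy, hy', hyy⟩ := hd' x₁ (g +ᵥ x₂)
    refine ⟨(y, -g +ᵥ y'), ⟨hy, ?_⟩, ?_⟩
    · have hm : MapsTo (fun p : X × M => (-g +ᵥ p.1, -g +ᵥ p.2)) Γ Γ := by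
        refine MapsTo.closure ?_ (((continuous_const_vadd (-g)).comp continuous_fst).prodMk
          ((continuous_const_vadd (-g)).comp continuous_snd))
        rintro _ ⟨x, rfl⟩
        exact ⟨-g +ᵥ x, Prod.ext rfl (hN _ _)⟩
      have : (-g +ᵥ y', -g +ᵥ N (g +ᵥ x₂)) ∈ Γ := hm hy'
      rwa [hN, neg_vadd_vadd] at this
    · have h2 : y' = (g +ᵥ (0 : X)) + (-g +ᵥ y') := by rw [← h1, vadd_neg_vadd]
      change y - (-g +ᵥ y') = g +ᵥ d
      rw [h1 g d, ← hyy]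
      nth_rewrite 2 [h2]
      abel
  have h0 : (0 : X) ∈ (fun p : X × X => p.1 - p.2) ''
      ({y | (y, N x₁) ∈ Γ} ×ˢ {y | (y, N x₂) ∈ Γ}) :=
    closure_minimal hsub hE (AddAction.dense_orbit G d 0)
  obtain ⟨⟨y, y'⟩, ⟨hy, hy'⟩, hyy⟩ := h0
  obtain rfl : y = y' := sub_eq_zero.1 hyy
  exact ⟨y, hy, hy'⟩

end Subsystem

end Dynamics

/-! ### The vague topology is regular and Hausdorff. -/

namespace LFMeasure

section Vague

variable {E : Type*} [TopologicalSpace E] [MeasurableSpace E]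

theorem tendsto_nhds_iff {α : Type*} {F : α → LFMeasure E} {l : Filter α} {ν : LFMeasure E} :
    Filter.Tendsto F l (𝓝 ν) ↔ ∀ f : C_c(E, ℝ),
      Filter.Tendsto (fun a => ∫ x, f x ∂(F a).toMeasure) l (𝓝 (∫ x, f x ∂ν.toMeasure)) := by
  simp only [nhds_iInf, nhds_induced, Filter.tendsto_iInf, Filter.tendsto_comap_iff,
    Function.comp_def]

theorem continuous_integral (f : C_c(E, ℝ)) :
    Continuous fun μ : LFMeasure E => ∫ x, f x ∂μ.toMeasure :=
  continuous_iff.1 continuous_id f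

instance : RegularSpace (LFMeasure E) :=
  regularSpace_iInf fun _ => regularSpace_induced _

variable [T2Space E] [LocallyCompactSpace E] [SecondCountableTopology E] [BorelSpace E]

theorem integrable (μ : LFMeasure E) (f : C_c(E, ℝ)) : Integrable f μ.toMeasure :=
  have := μ.locallyFinite
  f.continuous.integrable_of_hasCompactSupport f.hasCompactSupport

theorem ext_of_integral_eq {μ ν : LFMeasure E}
    (h : ∀ f : C_c(E, ℝ), ∫ x, f x ∂μ.toMeasure = ∫ x, f x ∂ν.toMeasure) : μ = ν := by
  have := μ.locallyFinite
  have := ν.locallyFinite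
  let _ := metrizableSpaceMetric E
  exact LFMeasure.ext (Measure.ext_of_integral_eq_on_compactlySupported h)

instance : T2Space (LFMeasure E) := by
  have : T0Space (LFMeasure E) := by
    refine ⟨fun μ ν h => ext_of_integral_eq fun f => ?_⟩
    exact (h.map (continuous_integral f)).eq
  infer_instance

end Vague

end LFMeasure

/-! ### Closures of graphs. -/

/-- The integral against a sum of point masses. -/
theorem integral_sum_dirac_subtype {E : Type*} [MeasurableSpace E] [MeasurableSingletonClass E]
    {P : Set E} {f : E → ℝ}
    (hf : Integrable f (Measure.sum fun y : P => Measure.dirac y.1)) :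
    ∫ x, f x ∂(Measure.sum fun y : P => Measure.dirac y.1) = ∑' y : P, f y := by
  rw [integral_sum_measure hf]
  simp only [integral_dirac]

/-- If `∫ f dN` vanishes off a closed set, then so does `∫ f dν` for the points of the closure of
the graph of `N`. -/
theorem integral_eq_zero_of_mem_closure_graph {X E : Type*} [TopologicalSpace X]
    [TopologicalSpace E] [MeasurableSpace E] {N : X → LFMeasure E} {x : X} {ν : LFMeasure E}
    (h : (x, ν) ∈ closure (range fun x => (x, N x))) (f : C_c(E, ℝ)) {K : Set X}
    (hK : IsClosed K) (hf : ∀ x' ∉ K, ∫ y, f y ∂(N x').toMeasure = 0) (hx : x ∉ K) :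
    ∫ y, f y ∂ν.toMeasure = 0 := by
  -- An open premise and a closed conclusion define a closed condition, so it passes from the graph
  -- to its closure.
  have hclosed : IsClosed {p : X × LFMeasure E | p.1 ∈ interior Kᶜ → ∫ y, f y ∂p.2.toMeasure = 0} :=
    isClosed_imp (isOpen_interior.preimage continuous_fst)
      (isClosed_eq ((LFMeasure.continuous_integral f).comp continuous_snd) continuous_const)
  refine closure_minimal ?_ hclosed h ?_
  · rintro _ ⟨x', rfl⟩ hx'
    exact hf x' (interior_subset hx')
  · rwa [hK.isOpen_compl.interior_eq]

/-- Over a continuity point, the closure of a graph is small. -/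
theorem tendsto_snd_of_continuousAt {X M : Type*} [TopologicalSpace X] [TopologicalSpace M]
    [RegularSpace M] {N : X → M} {x₀ : X} (h : ContinuousAt N x₀) :
    Filter.Tendsto Prod.snd
      (Filter.comap Prod.fst (𝓝 x₀) ⊓ Filter.principal (closure (range fun x => (x, N x))))
      (𝓝 (N x₀)) := by
  refine (closed_nhds_basis (N x₀)).tendsto_right_iff.2 ?_
  rintro V ⟨hV, hVc⟩
  obtain ⟨U, hU, hUo, hxU⟩ := mem_nhds_iff.1 (h hV)
  have hclosed : IsClosed {p : X × M | p.1 ∈ U → p.2 ∈ V} :=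
    isClosed_imp (hUo.preimage continuous_fst) (hVc.preimage continuous_snd)
  have hsub : closure (range fun x => (x, N x)) ⊆ {p : X × M | p.1 ∈ U → p.2 ∈ V} := by
    refine closure_minimal ?_ hclosed
    rintro _ ⟨x, rfl⟩ hx
    exact hU hx
  exact Filter.mem_of_superset (Filter.inter_mem_inf
    (Filter.preimage_mem_comap (hUo.mem_nhds hxU)) (Filter.mem_principal_self _))
    fun p hp => hsub hp.2 hp.1

/-- The principal filter at `(x₀, ν)` is finer than the one in `tendsto_snd_of_continuousAt`, so `ν`
and `N x₀` are limits of the same filter. -/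
theorem eq_of_mem_closure_graph {X M : Type*} [TopologicalSpace X] [TopologicalSpace M]
    [RegularSpace M] [T2Space M] {N : X → M} {x₀ : X} (h : ContinuousAt N x₀) {ν : M}
    (hν : (x₀, ν) ∈ closure (range fun x => (x, N x))) : ν = N x₀ := by
  have h1 : pure (x₀, ν) ≤
      Filter.comap Prod.fst (𝓝 x₀) ⊓ Filter.principal (closure (range fun x => (x, N x))) :=
    le_inf (Filter.map_le_iff_le_comap.1 (pure_le_nhds x₀)) (Filter.pure_le_principal _ |>.2 hν)
  exact tendsto_nhds_unique (tendsto_const_nhds (f := pure (x₀, ν)) (x := ν) |>.congr' (by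
    exact Filter.eventually_pure.2 rfl)) ((tendsto_snd_of_continuousAt h).mono_left h1)

/-! ### The torus rotation and the supports of configurations. -/

namespace ModelSet

variable {G : Type u} [AddCommGroup G] [TopologicalSpace G] [IsTopologicalAddGroup G]
  {H : Type v} [AddCommGroup H] [TopologicalSpace H] [IsTopologicalAddGroup H]

theorem vadd_add_torus (L : AddSubgroup (G × H)) (g : G) (x y : Torus L) :
    g +ᵥ (x + y) = (g +ᵥ x) + y :=
  (add_assoc _ _ _).symm

/-- The preimage in `G × H` of the orbit of `0` contains the product of `G` with the projection of
`L`, which is dense. All other orbits are translates of this one. -/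
theorem isMinimal_torus {L : AddSubgroup (G × H)} (hdense : Dense (Prod.snd '' (L : Set (G × H)))) :
    AddAction.IsMinimal G (Torus L) := by
  have hcl : Dense (((↑) : G × H → Torus L) ⁻¹' AddAction.orbit G (0 : Torus L)) := by
    have h1 : univ ×ˢ (Prod.snd '' (L : Set (G × H))) ⊆
        ((↑) : G × H → Torus L) ⁻¹' AddAction.orbit G (0 : Torus L) := by
      rintro ⟨g, _⟩ ⟨-, ⟨l, hl, rfl⟩⟩
      refine ⟨g - l.1, ?_⟩
      change (((g - l.1, 0) : G × H) : Torus L) + 0 = _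
      rw [add_zero, QuotientAddGroup.eq]
      have : -((g - l.1, 0) : G × H) + (g, l.2) = l := by ext <;> simp
      rw [this]
      exact hl
    exact (dense_univ.prod hdense).mono h1
  have h0 : Dense (AddAction.orbit G (0 : Torus L)) :=
    QuotientAddGroup.dense_preimage_mk.1 hcl
  refine ⟨fun x => ?_⟩
  have h2 : AddAction.orbit G x = (fun y => y + x) '' AddAction.orbit G (0 : Torus L) := by
    ext z
    constructor
    · rintro ⟨g, rfl⟩
      refine ⟨g +ᵥ (0 : Torus L), ⟨g, rfl⟩, ?_⟩
      change (g +ᵥ (0 : Torus L)) + x = g +ᵥ x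
      rw [← vadd_add_torus, zero_add]
    · rintro ⟨_, ⟨g, rfl⟩, rfl⟩
      refine ⟨g, ?_⟩
      change g +ᵥ x = (g +ᵥ (0 : Torus L)) + x
      rw [← vadd_add_torus, zero_add]
  rw [h2]
  exact (Homeomorph.addRight x).surjective.denseRange.dense_image (Homeomorph.addRight x).continuous h0

variable [T2Space G] [T2Space H]

theorem t2Space_torus (L : AddSubgroup (G × H)) [DiscreteTopology L] : T2Space (Torus L) := by
  have : IsClosed (L : Set (G × H)) := AddSubgroup.isClosed_of_discrete
  infer_instance

theorem isCompact_image_torus (L : AddSubgroup (G × H)) {K : Set (G × H)} (hK : IsCompact K) :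
    IsCompact (((↑) : G × H → Torus L) '' K) :=
  hK.image QuotientAddGroup.continuous_mk

/-- The points over `x` form a closed set. -/
theorem isClosed_points (L : AddSubgroup (G × H)) [DiscreteTopology L] (W : Compacts H)
    (x : Torus L) : IsClosed (points L W x) :=
  have := t2Space_torus L
  (isClosed_singleton.preimage (QuotientAddGroup.continuous_mk (N := L))).inter
    (W.isCompact.isClosed.preimage continuous_snd)

/-- The projections to `G` of the points over `x` form a closed set. -/
theorem isClosed_fst_points (L : AddSubgroup (G × H)) [DiscreteTopology L] (W : Compacts H)
    (x : Torus L) : IsClosed (Prod.fst '' points L W x) := by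
  have : CompactSpace W := isCompact_iff_compactSpace.1 W.isCompact
  have := t2Space_torus L
  have h : Prod.fst '' points L W x =
      Prod.fst '' ((fun p : G × W => (((p.1, p.2) : G × H) : Torus L)) ⁻¹' {x}) := by
    ext g
    constructor
    · rintro ⟨⟨g, h⟩, ⟨hy, hW⟩, rfl⟩
      exact ⟨(g, ⟨h, hW⟩), hy, rfl⟩
    · rintro ⟨⟨g, h⟩, hy, rfl⟩
      exact ⟨(g, h), ⟨hy, h.2⟩, rfl⟩
  rw [h]
  refine isClosedMap_fst_of_compactSpace _ (isClosed_singleton.preimage ?_)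
  exact QuotientAddGroup.continuous_mk.comp
    (continuous_fst.prodMk (continuous_subtype_val.comp continuous_snd))

/-- Choosing the projection of `K` as the window makes the window condition automatic. -/
theorem finite_coset_inter (L : AddSubgroup (G × H)) [DiscreteTopology L] (x : Torus L)
    {K : Set (G × H)} (hK : IsCompact K) : {y : G × H | (y : Torus L) = x ∧ y ∈ K}.Finite :=
  (finite_points_inter L ⟨Prod.snd '' K, hK.image continuous_snd⟩ x hK).subset
    fun y hy => ⟨⟨hy.1, y, hy.2, rfl⟩, hy.2⟩

variable [LocallyCompactSpace G] [SecondCountableTopology G] [MeasurableSpace G] [BorelSpace G]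
  [LocallyCompactSpace H] [SecondCountableTopology H] [MeasurableSpace H] [BorelSpace H]
  (L : AddSubgroup (G × H)) [DiscreteTopology L] (W : Compacts H)

theorem integral_nu (x : Torus L) (f : C_c(G × H, ℝ)) :
    ∫ y, f y ∂(nu L W x).toMeasure = ∑' y : points L W x, f y :=
  integral_sum_dirac_subtype ((nu L W x).integrable f)

theorem integral_nuG (x : Torus L) (f : C_c(G, ℝ)) :
    ∫ y, f y ∂(nuG L W x).toMeasure = ∑' y : points L W x, f y.1.1 := by
  have h1 : Integrable f ((nu L W x).toMeasure.map Prod.fst) := (nuG L W x).integrable f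
  have h2 : Integrable (fun y : G × H => f y.1) (nu L W x).toMeasure :=
    h1.comp_measurable measurable_fst
  change ∫ y, f y ∂((nu L W x).toMeasure.map Prod.fst) = _
  refine (integral_map measurable_fst.aemeasurable f.continuous.aestronglyMeasurable).trans ?_
  exact integral_sum_dirac_subtype h2

theorem summable_nu (x : Torus L) (f : C_c(G × H, ℝ)) :
    Summable fun y : points L W x => f y := by
  have h := (hasSum_integral_measure ((nu L W x).integrable f)).summable
  simpa only [integral_dirac] using h

theorem summable_nuG (x : Torus L) (f : C_c(G, ℝ)) :
    Summable fun y : points L W x => f y.1.1 := by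
  have h1 : Integrable f ((nu L W x).toMeasure.map Prod.fst) := (nuG L W x).integrable f
  have h := (hasSum_integral_measure (h1.comp_measurable measurable_fst)).summable
  simpa only [integral_dirac, Function.comp_apply] using h

variable {L W}

theorem nu_eq_iff_points_eq_empty {x : Torus L} :
    (nu L W x).toMeasure = 0 ↔ points L W x = ∅ := by
  constructor
  · intro h
    refine eq_empty_of_forall_notMem fun y hy => ?_
    have h1 : Measure.dirac y ≤ (nu L W x).toMeasure :=
      Measure.le_sum (fun y : points L W x => Measure.dirac y.1) ⟨y, hy⟩
    have h2 := h1 univ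
    rw [h] at h2
    simp at h2
  · intro h
    have : IsEmpty (points L W x) := isEmpty_coe_sort.2 h
    exact Measure.sum_of_isEmpty _

theorem one_le_integral_nu {x : Torus L} {f : C_c(G × H, ℝ)} (hf : ∀ y, 0 ≤ f y) {y : G × H}
    (hy : y ∈ points L W x) (hfy : 1 ≤ f y) : 1 ≤ ∫ y, f y ∂(nu L W x).toMeasure := by
  rw [integral_nu]
  exact hfy.trans ((summable_nu L W x f).le_tsum (⟨y, hy⟩ : points L W x) fun _ _ => hf _)

theorem one_le_integral_nuG {x : Torus L} {f : C_c(G, ℝ)} (hf : ∀ y, 0 ≤ f y) {y : G × H}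
    (hy : y ∈ points L W x) (hfy : 1 ≤ f y.1) : 1 ≤ ∫ y, f y ∂(nuG L W x).toMeasure := by
  rw [integral_nuG]
  exact hfy.trans ((summable_nuG L W x f).le_tsum (⟨y, hy⟩ : points L W x) fun _ _ => hf _)

/-- A bump function at a point off a closed set. -/
theorem exists_bump {E : Type*} [TopologicalSpace E] [T2Space E] [LocallyCompactSpace E]
    {y : E} {U : Set E} (hU : IsOpen U) (hy : y ∈ U) :
    ∃ f : C_c(E, ℝ), (∀ z, 0 ≤ f z) ∧ (∀ᶠ z in 𝓝 y, f z = 1) ∧ tsupport f ⊆ U := by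
  obtain ⟨k, hk, hyk, hkU⟩ := exists_compact_subset hU hy
  obtain ⟨k', hk', hyk', hkk'⟩ := exists_compact_subset isOpen_interior hyk
  obtain ⟨f, hf1, hf0, hfc, hf⟩ := exists_continuous_one_zero_of_isCompact hk'
    isOpen_interior.isClosed_compl (disjoint_compl_right_iff_subset.2 hkk')
  refine ⟨⟨f, hfc⟩, fun z => (hf z).1, ?_, ?_⟩
  · filter_upwards [mem_interior_iff_mem_nhds.1 hyk'] with z hz using hf1 hz
  · refine (closure_minimal ?_ hk.isClosed).trans hkU
    intro z hz
    by_contra hzk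
    exact hz (hf0 fun h => hzk (interior_subset h))

/-- A limit configuration over `x` is carried by `points L W x`. Indeed the cosets meeting `tsupport
f` over `W` form a compact, hence closed, subset of the torus, and `x` lies outside it. -/
theorem integral_eq_zero_of_mem_closure_graph_nu {x : Torus L} {ν : LFMeasure (G × H)}
    (h : (x, ν) ∈ closure (range fun x => (x, nu L W x))) (f : C_c(G × H, ℝ))
    (hf : Disjoint (tsupport f) (points L W x)) : ∫ y, f y ∂ν.toMeasure = 0 := by
  have := t2Space_torus L
  have hK : IsCompact (tsupport f ∩ Prod.snd ⁻¹' (W : Set H)) :=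
    f.hasCompactSupport.isCompact.inter_right (W.isCompact.isClosed.preimage continuous_snd)
  refine integral_eq_zero_of_mem_closure_graph h f (isCompact_image_torus L hK).isClosed ?_ ?_
  · intro x' hx'
    rw [integral_nu]
    refine (tsum_congr fun y => ?_).trans tsum_zero
    refine image_eq_zero_of_notMem_tsupport fun hy => hx' ⟨y, ⟨hy, y.2.2⟩, y.2.1⟩
  · rintro ⟨y, ⟨hy, hyW⟩, hyx⟩
    exact disjoint_left.1 hf hy ⟨hyx, hyW⟩

theorem integral_eq_zero_of_mem_closure_graph_nuG {x : Torus L} {ν : LFMeasure G}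
    (h : (x, ν) ∈ closure (range fun x => (x, nuG L W x))) (f : C_c(G, ℝ))
    (hf : Disjoint (tsupport f) (Prod.fst '' points L W x)) : ∫ y, f y ∂ν.toMeasure = 0 := by
  have := t2Space_torus L
  have hK : IsCompact (tsupport f ×ˢ (W : Set H)) := f.hasCompactSupport.isCompact.prod W.isCompact
  refine integral_eq_zero_of_mem_closure_graph h f (isCompact_image_torus L hK).isClosed ?_ ?_
  · intro x' hx'
    rw [integral_nuG]
    refine (tsum_congr fun y => ?_).trans tsum_zero
    exact image_eq_zero_of_notMem_tsupport fun hy => hx' ⟨y, ⟨hy, y.2.2⟩, y.2.1⟩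
  · rintro ⟨y, ⟨hy, hyW⟩, hyx⟩
    exact disjoint_left.1 hf hy ⟨y, ⟨hyx, hyW⟩, rfl⟩

/-- Upper semicontinuity of the point sets: a point of `x₁` missing from the closed set over `x`
would be detected by a bump function that has integral zero. -/
theorem points_subset_of_mem_closure_graph {x x₁ : Torus L}
    (h : (x, nu L W x₁) ∈ closure (range fun x => (x, nu L W x))) :
    points L W x₁ ⊆ points L W x := by
  intro y hy
  by_contra hyx
  obtain ⟨f, hf0, hf1, hfU⟩ := exists_bump (isClosed_points L W x).isOpen_compl hyx
  have h1 := one_le_integral_nu hf0 hy hf1.self_of_nhds.ge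
  rw [integral_eq_zero_of_mem_closure_graph_nu h f (disjoint_left.2 hfU)] at h1
  exact absurd h1 (by norm_num)

theorem fst_points_subset_of_mem_closure_graph {x x₁ : Torus L}
    (h : (x, nuG L W x₁) ∈ closure (range fun x => (x, nuG L W x))) :
    Prod.fst '' points L W x₁ ⊆ Prod.fst '' points L W x := by
  rintro _ ⟨y, hy, rfl⟩
  by_contra hyx
  obtain ⟨f, hf0, hf1, hfU⟩ := exists_bump (isClosed_fst_points L W x).isOpen_compl hyx
  have h1 := one_le_integral_nuG hf0 hy hf1.self_of_nhds.ge
  rw [integral_eq_zero_of_mem_closure_graph_nuG h f (disjoint_left.2 hfU)] at h1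
  exact absurd h1 (by norm_num)

/-! ### Limits and continuity of `ν_W`. -/

/-- The limit of `ν_W` along a filter that decides which points of a coset are kept. -/
theorem tendsto_integral_nu {a : G × H} {l : Filter (G × H)} (hl : l ≤ 𝓝 a) {P : Set (G × H)}
    (hP : ∀ y ∈ P, (y : Torus L) = a) (hin : ∀ y ∈ P, ∀ᶠ u in l, (y + (u - a)).2 ∈ W)
    (hout : ∀ y ∉ P, (y : Torus L) = a → ∀ᶠ u in l, (y + (u - a)).2 ∉ W) (f : C_c(G × H, ℝ)) :
    Filter.Tendsto (fun u : G × H => ∫ y, f y ∂(nu L W (u : Torus L)).toMeasure) l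
      (𝓝 (∑' y : P, f y)) := by
  obtain ⟨K, hK, haK⟩ := exists_compact_mem_nhds a
  -- Only the finitely many coset points in this compact set can be carried into `tsupport f` by a
  -- shift `u - a` with `u ∈ K`. This gives one finite index set `F` for all such `u`.
  have hS : IsCompact ((fun p : (G × H) × (G × H) => p.1 - (p.2 - a)) '' (tsupport f ×ˢ K)) :=
    (f.hasCompactSupport.isCompact.prod hK).image (by fun_prop)
  let F := (finite_coset_inter L (a : Torus L) hS).toFinset
  have hF : ∀ y u : G × H, u ∈ K → (y : Torus L) = a → f (y + (u - a)) ≠ 0 → y ∈ F := by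
    intro y u hu hy hfy
    rw [Finite.mem_toFinset]
    exact ⟨hy, (y + (u - a), u), ⟨subset_tsupport _ hfy, hu⟩, by simp⟩
  have hmk : ∀ y u : G × H, ((y + (u - a) : G × H) : Torus L) = u ↔ (y : Torus L) = a := by
    intro y u
    rw [QuotientAddGroup.mk_add, QuotientAddGroup.mk_sub, add_sub_left_comm, add_eq_left,
      sub_eq_zero]
  -- The coset of `u` is reindexed as the coset of `a` shifted by `u - a`, which turns convergence
  -- of integrals into termwise convergence of a finite sum.
  have h1 : ∀ u ∈ K, ∫ y, f y ∂(nu L W (u : Torus L)).toMeasure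
      = ∑ y ∈ F, (points L W (u : Torus L)).indicator f (y + (u - a)) := by
    intro u hu
    rw [integral_nu, tsum_subtype, ← (Equiv.addRight (u - a)).tsum_eq]
    refine tsum_eq_sum fun y hy => ?_
    change (points L W (u : Torus L)).indicator f (y + (u - a)) = 0
    by_contra hne
    exact hy (hF y u hu ((hmk y u).1 (mem_of_indicator_ne_zero hne).1)
      fun h0 => hne (indicator_apply_eq_zero.2 fun _ => h0))
  have h2 : ∑' y : P, f y = ∑ y ∈ F, P.indicator f y := by
    rw [tsum_subtype]
    refine tsum_eq_sum fun y hy => ?_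
    by_contra hne
    refine hy (hF y a (mem_of_mem_nhds haK) (hP y (mem_of_indicator_ne_zero hne)) ?_)
    rw [sub_self, add_zero]
    exact fun h0 => hne (indicator_apply_eq_zero.2 fun _ => h0)
  rw [h2]
  refine (tendsto_finsetSum F fun y hy => ?_).congr' (f₁ := fun u : G × H =>
    ∑ y ∈ F, (points L W (u : Torus L)).indicator f (y + (u - a))) ?_
  · have hya : (y : Torus L) = a := ((Finite.mem_toFinset _).1 hy).1
    by_cases hyP : y ∈ P
    · rw [indicator_of_mem hyP]
      have hc : ContinuousAt (fun u : G × H => f (y + (u - a))) a := by fun_prop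
      have hc' : Filter.Tendsto (fun u : G × H => f (y + (u - a))) l (𝓝 (f y)) := by
        have := hc.tendsto.mono_left hl
        rwa [sub_self, add_zero] at this
      refine hc'.congr' ?_
      filter_upwards [hin y hyP] with u hu
      have hm : y + (u - a) ∈ points L W (u : Torus L) := ⟨(hmk y u).2 hya, hu⟩
      exact (indicator_of_mem hm f).symm
    · rw [indicator_of_notMem hyP]
      refine tendsto_const_nhds.congr' ?_
      filter_upwards [hout y hyP hya] with u hu
      exact (indicator_of_notMem (fun h => hu h.2) f).symm
  · filter_upwards [hl haK] with u hu
    exact (h1 u hu).symm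

/-- Each coset point lies over the interior of `W` or over its open complement, and either position
survives small shifts. -/
theorem continuousAt_nu {x : Torus L} (hx : ∀ y ∈ points L W x, y.2 ∉ frontier (W : Set H)) :
    ContinuousAt (nu L W) x := by
  obtain ⟨a, rfl⟩ := QuotientAddGroup.mk_surjective x
  have hc : ∀ y : G × H, ContinuousAt (fun u : G × H => (y + (u - a)).2) a := fun y => by fun_prop
  change Filter.Tendsto _ (𝓝 (a : Torus L)) _
  rw [QuotientAddGroup.nhds_eq, Filter.tendsto_map'_iff, LFMeasure.tendsto_nhds_iff]
  intro f
  rw [integral_nu]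
  refine tendsto_integral_nu le_rfl (fun y hy => hy.1) ?_ ?_ f
  · intro y hy
    have hyW : y.2 ∈ interior (W : Set H) := by
      by_contra h
      exact hx y hy ⟨subset_closure hy.2, h⟩
    have := (hc y).eventually_mem (s := interior (W : Set H))
      (isOpen_interior.mem_nhds (by simpa using hyW))
    exact this.mono fun u hu => interior_subset hu
  · intro y hy hya
    have hyW : y.2 ∈ (W : Set H)ᶜ := fun h => hy ⟨hya, h⟩
    exact (hc y).eventually_mem (W.isCompact.isClosed.isOpen_compl.mem_nhds (by simpa using hyW))

/-- `ν_W` converges along every convergent ultrafilter. -/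
theorem exists_tendsto_nu (𝓤 : Ultrafilter (Torus L)) {x : Torus L} (h𝓤 : (𝓤 : Filter _) ≤ 𝓝 x) :
    ∃ ν, Filter.Tendsto (nu L W) 𝓤 (𝓝 ν) := by
  obtain ⟨a, rfl⟩ := QuotientAddGroup.mk_surjective x
  -- The quotient map sends neighbourhoods of `a` onto neighbourhoods of its class, so `𝓤` lifts to
  -- an ultrafilter converging to `a`.
  have hne : (Filter.comap ((↑) : G × H → Torus L) 𝓤 ⊓ 𝓝 a).NeBot := by
    rw [inf_comm, ← Filter.map_neBot_iff ((↑) : G × H → Torus L), Filter.push_pull,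
      ← QuotientAddGroup.nhds_eq, inf_of_le_right h𝓤]
    exact 𝓤.neBot
  let 𝓥 := Ultrafilter.of (Filter.comap ((↑) : G × H → Torus L) 𝓤 ⊓ 𝓝 a)
  have h𝓥 : (𝓥 : Filter (G × H)) ≤ Filter.comap ((↑) : G × H → Torus L) 𝓤 ⊓ 𝓝 a :=
    Ultrafilter.of_le _
  have hmap : 𝓥.map ((↑) : G × H → Torus L) = 𝓤 :=
    Ultrafilter.eq_of_le (Filter.map_le_iff_le_comap.2 (h𝓥.trans inf_le_left))
  -- The ultrafilter decides for each coset point whether its shifts stay over `W`. Since `W` is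
  -- closed, the points kept lie over `W`, so their Dirac comb is dominated by `ν_W` and is locally
  -- finite.
  let P : Set (G × H) := {y | (y : Torus L) = a ∧ ∀ᶠ u in (𝓥 : Filter (G × H)), (y + (u - a)).2 ∈ W}
  have hPW : P ⊆ points L W (a : Torus L) := by
    intro y hy
    refine ⟨hy.1, ?_⟩
    have hc : Filter.Tendsto (fun u : G × H => (y + (u - a)).2) 𝓥 (𝓝 (y + (a - a)).2) :=
      (Continuous.tendsto (by fun_prop) a).mono_left (h𝓥.trans inf_le_right)
    rw [sub_self, add_zero] at hc
    exact W.isCompact.isClosed.mem_of_tendsto hc hy.2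
  have hle : (Measure.sum fun y : P => Measure.dirac y.1) ≤ (nu L W (a : Torus L)).toMeasure := by
    refine Measure.le_iff.2 fun s hs => ?_
    change _ ≤ Measure.sum (fun y : points L W (a : Torus L) => Measure.dirac y.1) s
    rw [Measure.sum_apply _ hs, Measure.sum_apply _ hs]
    exact ENNReal.tsum_comp_le_tsum_of_injective (inclusion_injective hPW)
      fun y => Measure.dirac y.1 s
  have hlf : IsLocallyFiniteMeasure (Measure.sum fun y : P => Measure.dirac y.1) :=
    have := (nu L W (a : Torus L)).locallyFinite
    MeasureTheory.Measure.isLocallyFiniteMeasure_of_le hle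
  refine ⟨⟨Measure.sum fun y : P => Measure.dirac y.1, hlf⟩, ?_⟩
  rw [LFMeasure.tendsto_nhds_iff]
  intro f
  have hout : ∀ y ∉ P, (y : Torus L) = a →
      ∀ᶠ u in (𝓥 : Filter (G × H)), (y + (u - a)).2 ∉ W := fun y hy hya =>
    Ultrafilter.eventually_not.2 fun h => hy ⟨hya, h⟩
  rw [integral_sum_dirac_subtype ((LFMeasure.mk _ hlf).integrable f), ← hmap]
  exact Filter.tendsto_map'_iff.2 (tendsto_integral_nu (h𝓥.trans inf_le_right) (fun y hy => hy.1)
    (fun y hy => hy.2) hout f)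

end ModelSet

/-- Restricting an almost one-to-one extension along an injective map. -/
theorem IsAlmostOneOneExtension.comp_injective {G Y' Y X : Type*} [AddGroup G]
    [TopologicalSpace Y'] [TopologicalSpace Y] [TopologicalSpace X] [AddAction G Y']
    [AddAction G Y] [AddAction G X] {π : Y → X} (hπ : IsAlmostOneOneExtension G π) {ι : Y' → Y}
    (hι : Function.Injective ι) (hf : IsFactorMap G (π ∘ ι)) :
    IsAlmostOneOneExtension G (π ∘ ι) := by
  obtain ⟨-, D, hD, hDd, h⟩ := hπ
  refine ⟨hf, D, hD, hDd, fun x hx => ?_⟩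
  obtain ⟨y, hy⟩ := hf.surjective x
  exact ⟨y, hy, fun y' hy' => hι ((h x hx).unique hy' hy)⟩

namespace ModelSet

variable {G : Type u} [AddCommGroup G] [TopologicalSpace G] [IsTopologicalAddGroup G]
  {H : Type v} [AddCommGroup H] [TopologicalSpace H] [IsTopologicalAddGroup H]
  [T2Space G] [T2Space H]
  [LocallyCompactSpace G] [SecondCountableTopology G] [MeasurableSpace G] [BorelSpace G]
  [LocallyCompactSpace H] [SecondCountableTopology H] [MeasurableSpace H] [BorelSpace H]

/-! ### Genericity of cosets avoiding the boundary of `W`. -/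

section Generic

variable (L : AddSubgroup (G × H)) (W : Compacts H)

/-- The set of all `x` such that no point over `x` lies over the boundary of `W`. -/
def genericSet : Set (Torus L) := {x | ∀ y ∈ points L W x, y.2 ∉ frontier (W : Set H)}

variable [DiscreteTopology L]

/-- By σ-compactness of `G`, the complement is a countable union of images of compact sets. -/
theorem isGδ_genericSet : IsGδ (genericSet L W) := by
  have := t2Space_torus L
  have hfr : IsCompact (frontier (W : Set H)) :=
    W.isCompact.of_isClosed_subset isClosed_frontier W.isCompact.isClosed.frontier_subset
  have h : genericSet L W = ⋂ n : ℕ, (((↑) : G × H → Torus L) ''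
      (compactCovering G n ×ˢ frontier (W : Set H)))ᶜ := by
    ext x
    rw [mem_iInter]
    constructor
    · rintro hx n ⟨y, hy, rfl⟩
      exact hx y ⟨rfl, W.isCompact.isClosed.frontier_subset hy.2⟩ hy.2
    · intro hx y hy hyf
      obtain ⟨n, hn⟩ := exists_mem_compactCovering y.1
      exact hx n ⟨y, ⟨hn, hyf⟩, hy.1⟩
  rw [h]
  exact IsGδ.iInter_of_isOpen fun n =>
    (isCompact_image_torus L ((isCompact_compactCovering G n).prod hfr)).isClosed.isOpen_compl

/-- Baire category in `G × H`: `L` is countable, and for each `l` the condition on `u + l` is the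
preimage of an open dense set under an open map. -/
theorem dense_genericSet : Dense (genericSet L W) := by
  have : Countable L := TopologicalSpace.separableSpace_iff_countable.1 inferInstance
  rw [← QuotientAddGroup.dense_preimage_mk]
  have hmap : ∀ l : L, IsOpenMap fun u : G × H => (u + l).2 := fun l =>
    isOpenMap_snd.comp (Homeomorph.addRight (l : G × H)).isOpenMap
  have hd : Dense (⋂ l : L, (fun u : G × H => (u + l).2) ⁻¹' (frontier (W : Set H))ᶜ) := by
    refine dense_iInter_of_isOpen
      (fun l => isClosed_frontier.isOpen_compl.preimage (by fun_prop)) fun l => ?_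
    exact (interior_eq_empty_iff_dense_compl.1
      (interior_frontier W.isCompact.isClosed)).preimage (hmap l)
  refine hd.mono fun u hu y hy => ?_
  have h1 := mem_iInter.1 hu ⟨-u + y, QuotientAddGroup.eq.1 hy.1.symm⟩
  simpa using h1

variable {L W}

theorem genericSet_subset_continuitySet : genericSet L W ⊆ continuitySet L W :=
  fun _ hx => continuousAt_nu hx

theorem points_eq_empty_of_mem_genericSet (hW : interior (W : Set H) = ∅) {x : Torus L}
    (hx : x ∈ genericSet L W) : points L W x = ∅ :=
  eq_empty_of_forall_notMem fun y hy => hx y hy ⟨subset_closure hy.2, by simp [hW]⟩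

end Generic

/-! ### Windows with interior: configurations are nonzero and determine their coset. -/

section Window

variable {L : AddSubgroup (G × H)} [DiscreteTopology L] [CompactSpace (Torus L)] {W : Compacts H}

omit [DiscreteTopology L] [CompactSpace (Torus L)] in
theorem exists_mem_interior (hdense : Dense (Prod.snd '' (L : Set (G × H))))
    (hW : (interior (W : Set H)).Nonempty) (x : Torus L) :
    ∃ y : G × H, (y : Torus L) = x ∧ y.2 ∈ interior (W : Set H) := by
  obtain ⟨a, rfl⟩ := QuotientAddGroup.mk_surjective x
  obtain ⟨w, hw⟩ := hW
  obtain ⟨_, hl', l, hl, rfl⟩ := hdense.inter_open_nonempty ((fun h => a.2 + h) ⁻¹' interior W)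
    (isOpen_interior.preimage (by fun_prop)) ⟨-a.2 + w, by simpa using hw⟩
  exact ⟨a + l, (QuotientAddGroup.mk_add_of_mem a hl), hl'⟩

/-- If `W` has interior, the configurations are uniformly bounded away from zero. -/
theorem exists_one_le_integral_nu (hdense : Dense (Prod.snd '' (L : Set (G × H))))
    (hW : (interior (W : Set H)).Nonempty) :
    ∃ f : C_c(G × H, ℝ), ∀ x, 1 ≤ ∫ y, f y ∂(nu L W x).toMeasure := by
  suffices h : ∃ f : C_c(G × H, ℝ), (∀ y, 0 ≤ f y) ∧
      ∀ x ∈ (univ : Set (Torus L)), 1 ≤ ∫ y, f y ∂(nu L W x).toMeasure from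
    let ⟨f, _, hf⟩ := h
    ⟨f, fun x => hf x (mem_univ x)⟩
  -- Each torus point has a neighbourhood served by one bump function. A sum of finitely many
  -- nonnegative ones serves the whole torus.
  refine isCompact_univ.induction_on (p := fun s => ∃ f : C_c(G × H, ℝ), (∀ y, 0 ≤ f y) ∧
      ∀ x ∈ s, 1 ≤ ∫ y, f y ∂(nu L W x).toMeasure) ?_ ?_ ?_ ?_
  · exact ⟨0, fun y => le_rfl, fun x hx => hx.elim⟩
  · rintro s t hst ⟨f, hf0, hf⟩
    exact ⟨f, hf0, fun x hx => hf x (hst hx)⟩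
  · rintro s t ⟨f, hf0, hf⟩ ⟨f', hf0', hf'⟩
    refine ⟨f + f', fun y => add_nonneg (hf0 y) (hf0' y), fun x hx => ?_⟩
    have h1 : ∫ y, (f + f') y ∂(nu L W x).toMeasure = _ :=
      integral_add ((nu L W x).integrable f) ((nu L W x).integrable f')
    rw [h1]
    rcases hx with hx | hx
    · exact le_add_of_le_of_nonneg (hf x hx) (integral_nonneg hf0')
    · exact le_add_of_nonneg_of_le (integral_nonneg hf0) (hf' x hx)
  · intro x _
    obtain ⟨y, rfl, hy⟩ := exists_mem_interior hdense hW x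
    obtain ⟨f, hf0, hf1, -⟩ := exists_bump isOpen_univ (mem_univ y)
    have hev : ∀ᶠ z : G × H in 𝓝 y, f z = 1 ∧ z.2 ∈ interior (W : Set H) :=
      hf1.and (continuous_snd.continuousAt.eventually_mem (isOpen_interior.mem_nhds hy))
    refine ⟨((↑) : G × H → Torus L) '' {z | f z = 1 ∧ z.2 ∈ interior (W : Set H)}, ?_, f, hf0, ?_⟩
    · rw [nhdsWithin_univ, QuotientAddGroup.nhds_eq]
      exact Filter.image_mem_map hev
    · rintro _ ⟨z, hz, rfl⟩
      exact one_le_integral_nu hf0 ⟨rfl, interior_subset hz.2⟩ hz.1.ge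

/-- A nonzero configuration determines the point of the torus over which it lies. -/
theorem eq_of_mem_closure_graph_of_integral_ne_zero {x x' : Torus L} {ν : LFMeasure (G × H)}
    (h : (x, ν) ∈ closure (range fun x => (x, nu L W x)))
    (h' : (x', ν) ∈ closure (range fun x => (x, nu L W x))) (f : C_c(G × H, ℝ))
    (hf : ∫ y, f y ∂ν.toMeasure ≠ 0) : x = x' := by
  by_contra hne
  have := t2Space_torus L
  obtain ⟨A, hxA, hA, B, hxB, hB, hAB⟩ := exists_open_nhds_disjoint_closure hne
  -- Pulling `χ` back splits `f` into `f χ` and `f (1 - χ)`. The first vanishes near the coset of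
  -- `x` and the second near that of `x'`, so both integrals against `ν` are zero.
  obtain ⟨χ, hχA, hχB, -⟩ :=
    exists_continuous_zero_one_of_isClosed isClosed_closure isClosed_closure hAB
  have hcont : Continuous fun y : G × H => χ (y : Torus L) :=
    χ.continuous.comp QuotientAddGroup.continuous_mk
  have hzero : ∀ (z : Torus L) (F : C_c(G × H, ℝ)) (U : Set (Torus L)), IsOpen U → z ∈ U →
      (∀ y : G × H, (y : Torus L) ∈ U → F y = 0) → Disjoint (tsupport F) (points L W z) := by
    intro z F U hU hz hF
    have hc : IsClosed (((↑) : G × H → Torus L) ⁻¹' U)ᶜ :=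
      (hU.preimage QuotientAddGroup.continuous_mk).isClosed_compl
    have h1 : tsupport F ⊆ (((↑) : G × H → Torus L) ⁻¹' U)ᶜ :=
      closure_minimal (fun y hy hyU => hy (hF y hyU)) hc
    refine disjoint_left.2 fun y hy hyz => h1 hy ?_
    rw [mem_preimage, hyz.1]
    exact hz
  let F₁ : C_c(G × H, ℝ) := ⟨⟨fun y => f y * χ (y : Torus L), f.continuous.mul hcont⟩,
    f.hasCompactSupport.mul_right⟩
  let F₂ : C_c(G × H, ℝ) := ⟨⟨fun y => f y * (1 - χ (y : Torus L)),
    f.continuous.mul (continuous_const.sub hcont)⟩, f.hasCompactSupport.mul_right⟩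
  have h1 : ∫ y, F₁ y ∂ν.toMeasure = 0 := by
    refine integral_eq_zero_of_mem_closure_graph_nu h F₁ (hzero x F₁ A hA hxA fun y hy => ?_)
    change f y * χ (y : Torus L) = 0
    rw [hχA (subset_closure hy), Pi.zero_apply, mul_zero]
  have h2 : ∫ y, F₂ y ∂ν.toMeasure = 0 := by
    refine integral_eq_zero_of_mem_closure_graph_nu h' F₂ (hzero x' F₂ B hB hxB fun y hy => ?_)
    change f y * (1 - χ (y : Torus L)) = 0
    rw [hχB (subset_closure hy), Pi.one_apply, sub_self, mul_zero]
  have h3 : ∫ y, f y ∂ν.toMeasure = ∫ y, F₁ y ∂ν.toMeasure + ∫ y, F₂ y ∂ν.toMeasure := by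
    rw [← integral_add (ν.integrable F₁) (ν.integrable F₂)]
    refine integral_congr_ae (Filter.Eventually.of_forall fun y => ?_)
    change f y = f y * χ (y : Torus L) + f y * (1 - χ (y : Torus L))
    ring
  exact hf (by rw [h3, h1, h2, add_zero])

end Window

/-! ### The graph hull, the hull and their minimal parts. -/

section Graph

variable {L : AddSubgroup (G × H)} [DiscreteTopology L] [CompactSpace (Torus L)] {W : Compacts H}

theorem exists_mem_graphHull_of_mem_hull {ν : LFMeasure (G × H)} (hν : ν ∈ hull L W) :
    ∃ x, (x, ν) ∈ graphHull L W := by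
  have hcl : IsClosed (Prod.snd '' closure (range fun x => (x, nu L W x))) :=
    isClosedMap_snd_of_compactSpace _ isClosed_closure
  have hsub : range (nu L W) ⊆ Prod.snd '' closure (range fun x => (x, nu L W x)) := by
    rintro _ ⟨x, rfl⟩
    exact ⟨_, subset_closure ⟨x, rfl⟩, rfl⟩
  obtain ⟨⟨x, _⟩, hx, rfl⟩ := closure_minimal hsub hcl hν
  exact ⟨x, hx⟩

/-- Surjectivity onto the torus after restriction to continuity points: these are dense, and `ν_W`
has a limit along an ultrafilter of them converging to `x`. -/
theorem exists_mem_contGraphHull (x : Torus L) : ∃ ν, (x, ν) ∈ contGraphHull L W := by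
  have hd : Dense (continuitySet L W) := (dense_genericSet L W).mono genericSet_subset_continuitySet
  obtain ⟨𝓤, h𝓤, hx⟩ := mem_closure_iff_ultrafilter.1 (hd x)
  obtain ⟨ν, hν⟩ := exists_tendsto_nu (W := W) 𝓤 hx
  refine ⟨ν, mem_closure_of_tendsto (Filter.Tendsto.prodMk_nhds hx hν) ?_⟩
  filter_upwards [h𝓤] with y hy using ⟨y, hy, rfl⟩

/-- Minimality of the torus moves the first coordinate towards `x₀`, and continuity of `ν_W` there
forces the second coordinate to follow. -/
theorem mem_closure_orbit_of_mem_graphHull [AddAction.IsMinimal G (Torus L)] {x₀ : Torus L}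
    (hx₀ : x₀ ∈ continuitySet L W) {p : Torus L × LFMeasure (G × H)} (hp : p ∈ graphHull L W) :
    (x₀, nu L W x₀) ∈ closure (AddAction.orbit G p) := by
  have hne : (Filter.comap (fun g : G => g +ᵥ p.1) (𝓝 x₀)).NeBot :=
    Filter.comap_neBot_iff_frequently.2 (mem_closure_iff_frequently.1 (AddAction.dense_orbit G p.1 x₀))
  have h1 : Filter.Tendsto (fun g : G => g +ᵥ p.1) (Filter.comap (fun g : G => g +ᵥ p.1) (𝓝 x₀))
    (𝓝 x₀) := Filter.tendsto_comap
  have h2 : Filter.Tendsto (fun g : G => (g +ᵥ p).2)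
      (Filter.comap (fun g : G => g +ᵥ p.1) (𝓝 x₀)) (𝓝 (nu L W x₀)) :=
    (tendsto_snd_of_continuousAt hx₀).comp (Filter.tendsto_inf.2
      ⟨Filter.tendsto_comap_iff.2 h1, Filter.tendsto_principal.2
        (Filter.Eventually.of_forall fun g => (graphHull L W).vadd_mem g hp)⟩)
  exact mem_closure_of_tendsto (h1.prodMk_nhds h2) (Filter.Eventually.of_forall fun g => ⟨g, rfl⟩)

theorem mem_closure_orbit_of_mem_hull [AddAction.IsMinimal G (Torus L)] {x₀ : Torus L}
    (hx₀ : x₀ ∈ continuitySet L W) {ν : LFMeasure (G × H)} (hν : ν ∈ hull L W) :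
    nu L W x₀ ∈ closure (AddAction.orbit G ν) := by
  obtain ⟨x, hx⟩ := exists_mem_graphHull_of_mem_hull hν
  have h : MapsTo Prod.snd (AddAction.orbit G (x, ν)) (AddAction.orbit G ν) := by
    rintro _ ⟨g, rfl⟩
    exact ⟨g, rfl⟩
  exact h.closure continuous_snd (mem_closure_orbit_of_mem_graphHull hx₀ hx)

omit [CompactSpace (Torus L)] in
theorem isFactorMap_projTorus : IsFactorMap G (projTorus L W) :=
  ⟨continuous_fst.comp continuous_subtype_val,
    fun x => ⟨⟨(x, nu L W x), subset_closure ⟨x, rfl⟩⟩, rfl⟩, fun _ _ => rfl⟩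

omit [CompactSpace (Torus L)] in
theorem comap_projTorus_le {x₀ : Torus L} (hx₀ : x₀ ∈ continuitySet L W) :
    Filter.comap (projTorus L W) (𝓝 x₀) ≤
      𝓝 (⟨(x₀, nu L W x₀), subset_closure ⟨x₀, rfl⟩⟩ : graphHull L W) := by
  refine Filter.tendsto_id'.1 (tendsto_subtype_rng.2 ?_)
  have h1 : Filter.Tendsto (fun p : graphHull L W => p.1.1)
    (Filter.comap (projTorus L W) (𝓝 x₀)) (𝓝 x₀) := Filter.tendsto_comap
  refine h1.prodMk_nhds (my := fun p : graphHull L W => p.1.2) ?_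
  exact (tendsto_snd_of_continuousAt hx₀).comp (f := fun p : graphHull L W => p.1)
    (Filter.tendsto_inf.2 ⟨Filter.tendsto_comap_iff.2 h1, Filter.tendsto_principal.2
      (Filter.Eventually.of_forall fun p => p.2)⟩)

omit [CompactSpace (Torus L)] in
theorem isAlmostOneOneExtension_projTorus : IsAlmostOneOneExtension G (projTorus L W) := by
  refine ⟨isFactorMap_projTorus, genericSet L W, isGδ_genericSet L W, dense_genericSet L W,
    fun x hx => ⟨⟨(x, nu L W x), subset_closure ⟨x, rfl⟩⟩, rfl, ?_⟩⟩
  rintro ⟨⟨_, ν⟩, hν⟩ rfl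
  exact Subtype.ext (Prod.ext rfl (eq_of_mem_closure_graph (continuousAt_nu hx) hν))

theorem isEquicontinuousSystem_torus : IsEquicontinuousSystem G (Torus L) :=
  isEquicontinuousSystem_of_vadd_eq_add (vadd_add_torus L)

/-- The uniform bound `1 ≤ ∫ f` is closed, so it passes to limits, and a configuration satisfying it
determines its torus point. -/
theorem projHull_injective (hdense : Dense (Prod.snd '' (L : Set (G × H))))
    (hW : (interior (W : Set H)).Nonempty) : Function.Injective (projHull L W) := by
  rintro ⟨⟨x, ν⟩, hp⟩ ⟨⟨x', ν'⟩, hp'⟩ h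
  obtain rfl : ν = ν' := congrArg Subtype.val h
  obtain ⟨f, hf⟩ := exists_one_le_integral_nu hdense hW
  have h1 : 1 ≤ ∫ y, f y ∂ν.toMeasure := by
    have hcl : IsClosed {p : Torus L × LFMeasure (G × H) | 1 ≤ ∫ y, f y ∂p.2.toMeasure} :=
      isClosed_le continuous_const ((LFMeasure.continuous_integral f).comp continuous_snd)
    refine closure_minimal ?_ hcl hp
    rintro _ ⟨x, rfl⟩
    exact hf x
  exact Subtype.ext (Prod.ext
    (eq_of_mem_closure_graph_of_integral_ne_zero hp hp' f (zero_lt_one.trans_le h1).ne') rfl)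

theorem projHull_surjective : Function.Surjective (projHull L W) := fun ν =>
  let ⟨x, hx⟩ := exists_mem_graphHull_of_mem_hull ν.2
  ⟨⟨(x, ν.1), hx⟩, rfl⟩

omit [CompactSpace (Torus L)] in
theorem continuous_projHull : Continuous (projHull L W) :=
  (continuous_snd.comp continuous_subtype_val).subtype_mk _

theorem isClosedMap_projHull : IsClosedMap (projHull L W) := by
  intro s hs
  have hcl : IsClosed (graphHull L W : Set (Torus L × LFMeasure (G × H))) := isClosed_closure
  have h1 : IsClosed (Prod.snd '' (Subtype.val '' s : Set (Torus L × LFMeasure (G × H)))) :=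
    isClosedMap_snd_of_compactSpace _
      (hcl.isClosedEmbedding_subtypeVal.isClosedMap _ hs)
  have h2 : projHull L W '' s = Subtype.val ⁻¹' (Prod.snd '' (Subtype.val '' s)) := by
    ext ν
    constructor
    · rintro ⟨p, hp, rfl⟩
      exact ⟨_, ⟨p, hp, rfl⟩, rfl⟩
    · rintro ⟨_, ⟨p, hp, rfl⟩, hν⟩
      exact ⟨p, hp, Subtype.ext hν⟩
  rw [h2]
  exact h1.preimage continuous_subtype_val

/-- If `W` has interior, the projection of the graph hull to the hull is a homeomorphism. -/
noncomputable def homeomorphHull (hdense : Dense (Prod.snd '' (L : Set (G × H))))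
    (hW : (interior (W : Set H)).Nonempty) : graphHull L W ≃ₜ hull L W :=
  (Equiv.ofBijective (projHull L W)
    ⟨projHull_injective hdense hW, projHull_surjective⟩).toHomeomorphOfContinuousClosed
    continuous_projHull isClosedMap_projHull

theorem projTorus_homeomorphHull_symm (hdense : Dense (Prod.snd '' (L : Set (G × H))))
    (hW : (interior (W : Set H)).Nonempty) {x : Torus L} {ν : hull L W}
    (h : (x, ν.1) ∈ graphHull L W) :
    projTorus L W ((homeomorphHull hdense hW).symm ν) = x := by
  have h1 : homeomorphHull hdense hW ⟨(x, ν.1), h⟩ = ν := rfl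
  rw [← h1, Homeomorph.symm_apply_apply]
  rfl

theorem isFactorMap_projTorus_homeomorphHull (hdense : Dense (Prod.snd '' (L : Set (G × H))))
    (hW : (interior (W : Set H)).Nonempty) :
    IsFactorMap G (projTorus L W ∘ (homeomorphHull hdense hW).symm) := by
  refine ⟨isFactorMap_projTorus.continuous.comp (homeomorphHull hdense hW).symm.continuous,
    isFactorMap_projTorus.surjective.comp (homeomorphHull hdense hW).symm.surjective, ?_⟩
  intro g ν
  obtain ⟨x, hx⟩ := exists_mem_graphHull_of_mem_hull ν.2
  have h1 : (g +ᵥ x, (g +ᵥ ν).1) ∈ graphHull L W := (graphHull L W).vadd_mem g hx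
  rw [Function.comp_apply, Function.comp_apply, projTorus_homeomorphHull_symm hdense hW h1,
    projTorus_homeomorphHull_symm hdense hW hx]

theorem isFactorMap_projTorus_contHull (hdense : Dense (Prod.snd '' (L : Set (G × H))))
    (hW : (interior (W : Set H)).Nonempty) :
    IsFactorMap G (projTorus L W ∘ (homeomorphHull hdense hW).symm ∘
      subsystemInclusion (contHull_le L W)) := by
  have h := isFactorMap_projTorus_homeomorphHull hdense hW
  refine ⟨h.continuous.comp (continuous_subtype_val.subtype_mk _), fun x => ?_,
    fun g ν => h.map_vadd g (subsystemInclusion (contHull_le L W) ν)⟩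
  obtain ⟨ν, hν⟩ := exists_mem_contGraphHull (W := W) x
  have hν' : ν ∈ contHull L W := map_mem_closure continuous_snd hν (by
    rintro _ ⟨x, hx, rfl⟩
    exact ⟨x, hx, rfl⟩)
  exact ⟨⟨ν, hν'⟩, projTorus_homeomorphHull_symm hdense hW (contGraphHull_le L W hν)⟩

theorem isFactorMap_projTorus_contGraphHull :
    IsFactorMap G (projTorus L W ∘ subsystemInclusion (contGraphHull_le L W)) := by
  refine ⟨isFactorMap_projTorus.continuous.comp (continuous_subtype_val.subtype_mk _),
    fun x => ?_, fun g p => rfl⟩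
  obtain ⟨ν, hν⟩ := exists_mem_contGraphHull (W := W) x
  exact ⟨⟨(x, ν), hν⟩, rfl⟩

end Graph

/-! ### Windows without interior: the zero configuration and weak mixing. -/

section EmptyInterior

variable {L : AddSubgroup (G × H)} [DiscreteTopology L] {W : Compacts H}

/-- If the projected point sets over the torus are directed, then a window without interior is
empty. -/
theorem eq_empty_of_forall_exists_fst_points_subset [CompactSpace (Torus L)]
    (hinj : Set.InjOn Prod.fst (L : Set (G × H)))
    (hdense : Dense (Prod.snd '' (L : Set (G × H)))) (hW : interior (W : Set H) = ∅)
    (h : ∀ x₁ x₂ : Torus L, ∃ x, Prod.fst '' points L W x₁ ⊆ Prod.fst '' points L W x ∧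
      Prod.fst '' points L W x₂ ⊆ Prod.fst '' points L W x) : (W : Set H) = ∅ := by
  classical
  by_contra hne
  obtain ⟨w, hw⟩ := nonempty_iff_ne_empty.2 hne
  have := t2Space_torus L
  -- `K g` is the compact set of cosets having a point over `W` with `G`-coordinate `g`.
  -- Directedness, together with the class of `(g, w)`, gives these sets the finite intersection
  -- property.
  let K : G → Set (Torus L) := fun g => ((↑) : G × H → Torus L) '' ({g} ×ˢ (W : Set H))
  have hK : ∀ {g x}, x ∈ K g ↔ g ∈ Prod.fst '' points L W x := by
    intro g x
    constructor
    · rintro ⟨y, ⟨hy, hyW⟩, rfl⟩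
      exact ⟨y, ⟨rfl, hyW⟩, hy⟩
    · rintro ⟨y, hy, rfl⟩
      exact ⟨y, ⟨rfl, hy.2⟩, hy.1⟩
  have hfin : ∀ F : Finset G, (⋂ g ∈ F, K g).Nonempty := by
    intro F
    induction F using Finset.induction_on with
    | empty => exact ⟨0, by simp⟩
    | insert g F _ ih =>
      obtain ⟨x₁, hx₁⟩ := ih
      obtain ⟨x, hx, hx'⟩ := h x₁ ((g, w) : G × H)
      refine ⟨x, mem_iInter₂.2 fun g' hg' => hK.2 ?_⟩
      rcases Finset.mem_insert.1 hg' with rfl | hg'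
      · exact hx' ⟨(g', w), ⟨rfl, hw⟩, rfl⟩
      · exact hx (hK.1 (mem_iInter₂.1 hx₁ g' hg'))
  obtain ⟨x, hx⟩ : (⋂ g, K g).Nonempty := by
    by_contra hcon
    obtain ⟨F, hF⟩ := isCompact_univ.elim_finite_subfamily_closed K
      (fun g => (isCompact_image_torus L (isCompact_singleton.prod W.isCompact)).isClosed)
      (by rw [univ_inter]; exact not_nonempty_iff_eq_empty.1 hcon)
    rw [univ_inter] at hF
    exact (hfin F).ne_empty hF
  -- For each `l ∈ L` some point of the coset over `W` has the same `G`-coordinate as `a + l`.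
  -- Injectivity of the projection on `L` identifies it with `a + l`, so `a.2 + l.2 ∈ W`, and
  -- density then gives `W = H`.
  obtain ⟨a, rfl⟩ := QuotientAddGroup.mk_surjective x
  have hsub : Prod.snd '' (L : Set (G × H)) ⊆ (fun h => a.2 + h) ⁻¹' (W : Set H) := by
    rintro _ ⟨l, hl, rfl⟩
    obtain ⟨y, ⟨hy, hyW⟩, hyl⟩ := hK.1 (mem_iInter.1 hx (a + l).1)
    have h1 : -a + y ∈ L := QuotientAddGroup.eq.1 hy.symm
    have h2 : -a + y = l := hinj h1 hl (by
      rw [Prod.fst_add, hyl, Prod.fst_add, Prod.fst_neg, neg_add_cancel_left])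
    change a.2 + l.2 ∈ (W : Set H)
    rw [← h2, Prod.snd_add, Prod.snd_neg, add_neg_cancel_left]
    exact hyW
  have hall : ∀ h : H, h ∈ (W : Set H) := by
    intro h
    have h1 := closure_minimal hsub (W.isCompact.isClosed.preimage (by fun_prop)) (hdense (-a.2 + h))
    rwa [mem_preimage, add_neg_cancel_left] at h1
  rw [eq_univ_of_forall hall, interior_univ] at hW
  exact notMem_empty (0 : H) (hW ▸ mem_univ _)

theorem subsingleton_hull_of_eq_empty (hW : (W : Set H) = ∅) : Subsingleton (hull L W) := by
  have h0 : ∀ x, nu L W x = nu L W 0 := fun x => LFMeasure.ext (by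
    have : ∀ x, (nu L W x).toMeasure = 0 := fun x => nu_eq_iff_points_eq_empty.2
      (eq_empty_of_forall_notMem fun y hy => notMem_empty _ (hW ▸ hy.2 : y.2 ∈ (∅ : Set H)))
    rw [this, this])
  have h1 : (hull L W : Set (LFMeasure (G × H))) ⊆ {nu L W 0} :=
    closure_minimal (by rintro _ ⟨x, rfl⟩; exact h0 x) isClosed_singleton
  exact ⟨fun μ ν => Subtype.ext ((h1 μ.2).trans (h1 ν.2).symm)⟩

theorem nuG_eq_zero {x : Torus L} (h : points L W x = ∅) : (nuG L W x).toMeasure = 0 := by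
  change (nu L W x).toMeasure.map Prod.fst = 0
  rw [nu_eq_iff_points_eq_empty.2 h, Measure.map_zero]

theorem subsingleton_hullG_of_eq_empty (hW : (W : Set H) = ∅) : Subsingleton (hullG L W) := by
  have h0 : ∀ x, nuG L W x = nuG L W 0 := fun x => LFMeasure.ext (by
    have : ∀ x, (nuG L W x).toMeasure = 0 := fun x => nuG_eq_zero
      (eq_empty_of_forall_notMem fun y hy => notMem_empty _ (hW ▸ hy.2 : y.2 ∈ (∅ : Set H)))
    rw [this, this])
  have h1 : (hullG L W : Set (LFMeasure G)) ⊆ {nuG L W 0} :=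
    closure_minimal (by rintro _ ⟨x, rfl⟩; exact h0 x) isClosed_singleton
  exact ⟨fun μ ν => Subtype.ext ((h1 μ.2).trans (h1 ν.2).symm)⟩

/-- For a window without interior, the hull on `G` is a single point only if `W = ∅`. -/
theorem natCard_hullG_eq_one_iff (hW : interior (W : Set H) = ∅) :
    Nat.card (hullG L W) = 1 ↔ (W : Set H) = ∅ := by
  rw [Nat.card_eq_one_iff_unique]
  constructor
  · rintro ⟨hs, -⟩
    refine eq_empty_of_forall_notMem fun w hw => ?_
    -- A point `w ∈ W` would give two different configurations: the one over `(0, w)` charges `0`,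
    -- while the generic one vanishes.
    obtain ⟨x₀, hx₀⟩ := (dense_genericSet L W).nonempty
    have h1 : nuG L W ((0, w) : G × H) = nuG L W x₀ := congrArg Subtype.val
      (hs.elim (⟨_, subset_closure ⟨_, rfl⟩⟩ : hullG L W) ⟨_, subset_closure ⟨_, rfl⟩⟩)
    obtain ⟨f, hf0, hf1, -⟩ := exists_bump isOpen_univ (mem_univ (0 : G))
    have h2 := one_le_integral_nuG (L := L) (W := W) hf0 (y := ((0, w) : G × H)) ⟨rfl, hw⟩
      hf1.self_of_nhds.ge
    rw [h1, nuG_eq_zero (points_eq_empty_of_mem_genericSet hW hx₀), integral_zero_measure] at h2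
    exact absurd h2 (by norm_num)
  · intro h
    exact ⟨subsingleton_hullG_of_eq_empty h, ⟨⟨_, subset_closure ⟨0, rfl⟩⟩⟩⟩

theorem exists_fixedPoint_hull (hW : interior (W : Set H) = ∅) :
    ∃ ν : hull L W, ∀ g : G, g +ᵥ ν = ν := by
  obtain ⟨x₀, hx₀⟩ := (dense_genericSet L W).nonempty
  refine ⟨⟨_, subset_closure ⟨x₀, rfl⟩⟩, fun g => Subtype.ext (LFMeasure.ext ?_)⟩
  change (nu L W x₀).toMeasure.map _ = (nu L W x₀).toMeasure
  rw [nu_eq_iff_points_eq_empty.2 (points_eq_empty_of_mem_genericSet hW hx₀), Measure.map_zero]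

theorem exists_fixedPoint_hullG (hW : interior (W : Set H) = ∅) :
    ∃ ν : hullG L W, ∀ g : G, g +ᵥ ν = ν := by
  obtain ⟨x₀, hx₀⟩ := (dense_genericSet L W).nonempty
  refine ⟨⟨_, subset_closure ⟨x₀, rfl⟩⟩, fun g => Subtype.ext (LFMeasure.ext ?_)⟩
  change (nuG L W x₀).toMeasure.map _ = (nuG L W x₀).toMeasure
  rw [nuG_eq_zero (points_eq_empty_of_mem_genericSet hW hx₀), Measure.map_zero]

theorem isTopologicallyWeaklyMixing_hull_iff [CompactSpace (Torus L)]
    (hinj : Set.InjOn Prod.fst (L : Set (G × H)))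
    (hdense : Dense (Prod.snd '' (L : Set (G × H)))) (hW : interior (W : Set H) = ∅) :
    IsTopologicallyWeaklyMixing G (hull L W) ↔ (W : Set H) = ∅ := by
  have := t2Space_torus L
  have := isMinimal_torus hdense
  constructor
  · intro h
    refine eq_empty_of_forall_exists_fst_points_subset hinj hdense hW fun x₁ x₂ => ?_
    obtain ⟨x, h1, h2⟩ := exists_mem_closure_graph_of_isTopologicallyWeaklyMixing
      (vadd_add_torus L) (nu_vadd L W) _ h x₁ x₂
    exact ⟨x, image_mono (points_subset_of_mem_closure_graph h1),
      image_mono (points_subset_of_mem_closure_graph h2)⟩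
  · intro h
    have := subsingleton_hull_of_eq_empty (L := L) h
    exact isTopologicallyWeaklyMixing_of_subsingleton

theorem isTopologicallyWeaklyMixing_hullG_iff [CompactSpace (Torus L)]
    (hinj : Set.InjOn Prod.fst (L : Set (G × H)))
    (hdense : Dense (Prod.snd '' (L : Set (G × H)))) (hW : interior (W : Set H) = ∅) :
    IsTopologicallyWeaklyMixing G (hullG L W) ↔ (W : Set H) = ∅ := by
  have := t2Space_torus L
  have := isMinimal_torus hdense
  constructor
  · intro h
    refine eq_empty_of_forall_exists_fst_points_subset hinj hdense hW fun x₁ x₂ => ?_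
    obtain ⟨x, h1, h2⟩ := exists_mem_closure_graph_of_isTopologicallyWeaklyMixing
      (vadd_add_torus L) (nuG_vadd L W) _ h x₁ x₂
    exact ⟨x, fst_points_subset_of_mem_closure_graph h1, fst_points_subset_of_mem_closure_graph h2⟩
  · intro h
    have := subsingleton_hullG_of_eq_empty (L := L) h
    exact isTopologicallyWeaklyMixing_of_subsingleton

end EmptyInterior

end ModelSet

/-! ### Assembly of the two cases. -/

theorem mainTheorem4
    {G : Type u} [AddCommGroup G] [TopologicalSpace G] [IsTopologicalAddGroup G]
    [T2Space G] [LocallyCompactSpace G] [SecondCountableTopology G]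
    [MeasurableSpace G] [BorelSpace G]
    {H : Type v} [AddCommGroup H] [TopologicalSpace H] [IsTopologicalAddGroup H]
    [T2Space H] [LocallyCompactSpace H] [SecondCountableTopology H]
    [MeasurableSpace H] [BorelSpace H]
    (L : AddSubgroup (G × H)) [DiscreteTopology L] [CompactSpace (Torus L)]
    (hinj : Set.InjOn Prod.fst (L : Set (G × H)))
    (hdense : Dense (Prod.snd '' (L : Set (G × H))))
    (W : Compacts H) :
    ((interior (W : Set H)).Nonempty →
      zeroSet L W = ∅ ∧
      IsMaximalEquicontinuousFactor G (projTorus L W) ∧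
      IsAlmostOneOneExtension G (projTorus L W) ∧
      (∃ e : graphHull L W ≃ₜ hull L W, ⇑e = projHull L W ∧
        IsMaximalEquicontinuousFactor G (projTorus L W ∘ e.symm) ∧
        IsAlmostOneOneExtension G (projTorus L W ∘ e.symm) ∧
        IsAlmostAutomorphicExtension G
          (projTorus L W ∘ e.symm ∘ subsystemInclusion (contHull_le L W))) ∧
      (Nontrivial (Torus L) →
        ¬ IsTopologicallyWeaklyMixing G (graphHull L W) ∧
        ¬ IsTopologicallyWeaklyMixing G (hull L W)) ∧
      IsAlmostAutomorphicExtension G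
        (projTorus L W ∘ subsystemInclusion (contGraphHull_le L W)) ∧
      (∀ N, IsMinimalSubsystem N (graphHull L W) ↔ N = contGraphHull L W) ∧
      (∀ N, IsMinimalSubsystem N (hull L W) ↔ N = contHull L W)) ∧
    (interior (W : Set H) = ∅ →
      (zeroSet L W).Nonempty ∧
      IsMaximalEquicontinuousFactor G (projTorus L W) ∧
      IsAlmostOneOneExtension G (projTorus L W) ∧
      HasNoNontrivialMinimalEquicontinuousFactor G (hull L W) ∧
      HasNoNontrivialMinimalEquicontinuousFactor G (hullG L W) ∧
      (IsTopologicallyWeaklyMixing G (hull L W) ↔ Nat.card (hullG L W) = 1) ∧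
      (IsTopologicallyWeaklyMixing G (hullG L W) ↔ Nat.card (hullG L W) = 1)) := by
  have := t2Space_torus L
  have := isMinimal_torus hdense
  obtain ⟨x₀, hx₀⟩ := (dense_genericSet L W).nonempty
  have hx₀c := genericSet_subset_continuitySet hx₀
  have hMEF : IsMaximalEquicontinuousFactor G (projTorus L W) :=
    isFactorMap_projTorus.isMaximalEquicontinuousFactor isEquicontinuousSystem_torus
      (comap_projTorus_le hx₀c)
  have hA := isAlmostOneOneExtension_projTorus (L := L) (W := W)
  have hC : (continuitySet L W).Nonempty := ⟨x₀, hx₀c⟩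
  have horbG : ∀ p ∈ graphHull L W, (fun x => (x, nu L W x)) '' continuitySet L W ⊆
      closure (AddAction.orbit G p) := by
    rintro p hp _ ⟨x, hx, rfl⟩
    exact mem_closure_orbit_of_mem_graphHull hx hp
  have horb : ∀ ν ∈ hull L W, nu L W '' continuitySet L W ⊆ closure (AddAction.orbit G ν) := by
    rintro ν hν _ ⟨x, hx, rfl⟩
    exact mem_closure_orbit_of_mem_hull hx hν
  refine ⟨fun hW => ?_, fun hW => ?_⟩
  · let e := homeomorphHull hdense hW
    have he : IsFactorMap G (projTorus L W ∘ e.symm) :=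
      isFactorMap_projTorus_homeomorphHull hdense hW
    have hAe := hA.comp_injective e.symm.injective he
    refine ⟨eq_empty_of_forall_notMem fun x hx => ?_, hMEF, hA, ⟨e, rfl, ?_, hAe, ?_, ?_⟩,
      fun _ => ⟨?_, ?_⟩, ⟨?_, ?_⟩, fun N => ?_, fun N => ?_⟩
    · obtain ⟨y, hy, hyW⟩ := exists_mem_interior hdense hW x
      exact notMem_empty y
        (nu_eq_iff_points_eq_empty.1 hx ▸ (⟨hy, interior_subset hyW⟩ : y ∈ points L W x))
    · refine he.isMaximalEquicontinuousFactor isEquicontinuousSystem_torus (x₀ := x₀)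
        (p₀ := e ⟨(x₀, nu L W x₀), subset_closure ⟨x₀, rfl⟩⟩) ?_
      -- The homeomorphism transports the smallness of fibres near `x₀` from the graph hull to the
      -- hull.
      rw [← Filter.comap_comap, ← e.symm_symm, ← e.symm.comap_nhds_eq]
      exact Filter.comap_mono (comap_projTorus_le hx₀c)
    · exact isMinimal_closureSubsystem _ (contHull_le L W) horb
    · refine hAe.comp_injective (ι := subsystemInclusion (contHull_le L W)) ?_
        (isFactorMap_projTorus_contHull hdense hW)
      exact fun a b hab => Subtype.ext (congrArg (fun z : hull L W => z.1) hab)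
    · exact isFactorMap_projTorus.not_isTopologicallyWeaklyMixing (vadd_add_torus L)
    · exact he.not_isTopologicallyWeaklyMixing (vadd_add_torus L)
    · exact isMinimal_closureSubsystem _ (contGraphHull_le L W) horbG
    · refine hA.comp_injective ?_ isFactorMap_projTorus_contGraphHull
      exact fun a b hab => Subtype.ext (congrArg (fun z : graphHull L W => z.1) hab)
    · exact isMinimalSubsystem_iff_eq_closureSubsystem _ (hC.image _) (contGraphHull_le L W) horbG N
    · exact isMinimalSubsystem_iff_eq_closureSubsystem _ (hC.image _) (contHull_le L W) horb N
  · obtain ⟨ν, hν⟩ := exists_fixedPoint_hull (L := L) hW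
    obtain ⟨ν', hν'⟩ := exists_fixedPoint_hullG (L := L) hW
    refine ⟨⟨x₀, nu_eq_iff_points_eq_empty.2 (points_eq_empty_of_mem_genericSet hW hx₀)⟩, hMEF, hA,
      hasNoNontrivialMinimalEquicontinuousFactor_of_fixedPoint hν,
      hasNoNontrivialMinimalEquicontinuousFactor_of_fixedPoint hν', ?_, ?_⟩
    · rw [natCard_hullG_eq_one_iff hW, isTopologicallyWeaklyMixing_hull_iff hinj hdense hW]
    · rw [natCard_hullG_eq_one_iff hW, isTopologicallyWeaklyMixing_hullG_iff hinj hdense hW]
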